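/- Let $p_0,\dots,p_{n-1}$ be points of $\mathbb{R}^2$ listed in order of time (arbitrary points: coincidences and collinearities are allowed). The \emph{decomposition tree} of these points is the balanced binary tree over time whose node of height $k$ and position $b$ (for $0\le k\le\lceil\log_2 n\rceil$, $b2^k<n$) covers the points $p_t$ with $b2^k\le t<(b+1)2^k$; the children of node $(k+1,b)$ are the nodes $(k,2b)$ and, if it exists, $(k,2b+1)$. Each node is stored with pointers to its parent, its children and its two neighbours on its level, and with the array of the vertices of the convex hull of the points it covers, in clockwise order beginning with the lexicographically largest one, together with the length of this array and the position in it of the lexicographically smallest vertex. An array of pointers to the leaves $(0,t)$ is stored as well. There are a fixed program for a real RAM (unit-cost instructions and comparisons on registers holding natural numbers or reals, and random access to a read-only memory) and a constant $C$ such that the following holds for all $n$ and $p_0,\dots,p_{n-1}$. Run the program on any memory that holds the decomposition tree of these points, with the input $0\le i\le j<n$ and $q\in\mathbb{R}^2$ and the address of the array of leaves. Let $w=j-i+1$ be the number of points in the window $[p_i,p_j]$, and let $K$ be the convex hull of $p_i,\dots,p_j$. Then the program halts after at most $C\,(1+\lfloor\log_2 w\rfloor)^2$ steps, hence in $O(\log^2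 w)$ time for $w\ge 2$, and - if $q\in K$, it reports an exception; - if $q\notin K$, it reports two points $u,v\in K$ such that the set of tangents of $K$ through $q$ is $\{qu,qv\}$, where a tangent of $K$ is a line that meets $K$ and has $K$ on one side (in the closed half-plane), and $qu$, $qv$ are the lines through $q$ and $u$, and through $q$ and $v$. (The two tangents coincide exactly when $K$ lies on a line through $q$.) -/

import Mathlib

namespace WindowHull

/-! ### A real RAM

Two banks of registers (natural numbers and reals) and two banks of random access memory, which a
query only reads.  The arithmetic is `+`, `-`, halving on natural numbers and `+`, `-`, `*` on reals;
every instruction and every test costs one step.  There is no rounding of reals, no multiplication of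
natural numbers, and no transfer between the banks. -/

/-- The memory of the machine: addresses are natural numbers. -/
structure Memory where
  nat : ℕ → ℕ
  real : ℕ → ℝ

/-- The registers of the machine. -/
structure Regs where
  nat : ℕ → ℕ
  real : ℕ → ℝ

/-- Instructions; the first argument is the destination register. -/
inductive Instr where
  | natConst (d c : ℕ)
  | natCopy (d a : ℕ)
  | natAdd (d a b : ℕ)
  | natSub (d a b : ℕ)
  | natHalf (d a : ℕ)
  | natLoad (d a : ℕ)
  | realConst (d : ℕ) (c : ℤ)
  | realCopy (d a : ℕ)
  | realAdd (d a b : ℕ)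
  | realSub (d a b : ℕ)
  | realMul (d a b : ℕ)
  | realLoad (d a : ℕ)

/-- The effect of one instruction on the registers. -/
noncomputable def Instr.apply (mem : Memory) (s : Regs) : Instr → Regs
  | .natConst d c => { s with nat := Function.update s.nat d c }
  | .natCopy d a => { s with nat := Function.update s.nat d (s.nat a) }
  | .natAdd d a b => { s with nat := Function.update s.nat d (s.nat a + s.nat b) }
  | .natSub d a b => { s with nat := Function.update s.nat d (s.nat a - s.nat b) }
  | .natHalf d a => { s with nat := Function.update s.nat d (s.nat a / 2) }
  | .natLoad d a => { s with nat := Function.update s.nat d (mem.nat (s.nat a)) }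
  | .realConst d c => { s with real := Function.update s.real d (c : ℝ) }
  | .realCopy d a => { s with real := Function.update s.real d (s.real a) }
  | .realAdd d a b => { s with real := Function.update s.real d (s.real a + s.real b) }
  | .realSub d a b => { s with real := Function.update s.real d (s.real a - s.real b) }
  | .realMul d a b => { s with real := Function.update s.real d (s.real a * s.real b) }
  | .realLoad d a => { s with real := Function.update s.real d (mem.real (s.nat a)) }

/-- Tests: comparisons of two registers. -/
inductive Test where
  | natLt (a b : ℕ)
  | natLe (a b : ℕ)
  | natEq (a b : ℕ)
  | realLt (a b : ℕ)
  | realLe (a b : ℕ)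
  | realEq (a b : ℕ)

/-- The truth of a test. -/
def Test.Holds (s : Regs) : Test → Prop
  | .natLt a b => s.nat a < s.nat b
  | .natLe a b => s.nat a ≤ s.nat b
  | .natEq a b => s.nat a = s.nat b
  | .realLt a b => s.real a < s.real b
  | .realLe a b => s.real a ≤ s.real b
  | .realEq a b => s.real a = s.real b

/-- Programs. A program is a finite object that does not depend on the input. -/
inductive Program where
  | instr (i : Instr)
  | seq (c d : Program)
  | ite (e : Test) (c d : Program)
  | loop (e : Test) (c : Program)

/-- `Exec mem c s t s'`: started with registers `s` on the memory `mem`, the program `c` halts after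
exactly `t` steps with registers `s'`. -/
inductive Exec (mem : Memory) : Program → Regs → ℕ → Regs → Prop
  | instr (i : Instr) (s : Regs) : Exec mem (.instr i) s 1 (i.apply mem s)
  | seq {c d : Program} {s s' s'' : Regs} {t t' : ℕ} :
      Exec mem c s t s' → Exec mem d s' t' s'' → Exec mem (.seq c d) s (t + t') s''
  | iteTrue {e : Test} {c d : Program} {s s' : Regs} {t : ℕ} :
      e.Holds s → Exec mem c s t s' → Exec mem (.ite e c d) s (t + 1) s'
  | iteFalse {e : Test} {c d : Program} {s s' : Regs} {t : ℕ} :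
      ¬ e.Holds s → Exec mem d s t s' → Exec mem (.ite e c d) s (t + 1) s'
  | loopDone {e : Test} {c : Program} {s : Regs} :
      ¬ e.Holds s → Exec mem (.loop e c) s 1 s
  | loopStep {e : Test} {c : Program} {s s' s'' : Regs} {t t' : ℕ} :
      e.Holds s → Exec mem c s t s' → Exec mem (.loop e c) s' t' s'' →
        Exec mem (.loop e c) s (t + t' + 1) s''

/-! ### Stored convex hulls -/

/-- Twice the signed area of the triangle `a b c`; negative for a clockwise turn. -/
def orient (a b c : ℝ × ℝ) : ℝ :=
  (b.1 - a.1) * (c.2 - a.2) - (b.2 - a.2) * (c.1 - a.1)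

/-- `v` lists, without repetition, the vertices of the convex hull of `S` in clockwise order,
beginning with the lexicographically largest point, and `m` is the position of the lexicographically
smallest one. -/
structure IsClockwiseHull (S : Set (ℝ × ℝ)) (h : ℕ) (v : ℕ → ℝ × ℝ) (m : ℕ) : Prop where
  distinct : ∀ a b, a < b → b < h → v a ≠ v b
  vertices : v '' {t | t < h} = Set.extremePoints ℝ (convexHull ℝ S)
  clockwise : ∀ a b c, a < b → b < c → c < h → orient (v a) (v b) (v c) < 0
  first_max : ∀ z ∈ S, toLex z ≤ toLex (v 0)
  min_lt : m < h
  min_le : ∀ z ∈ S, toLex (v m) ≤ toLex z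

/-- The `t`-th entry of an array of points at address `base` of the real memory. -/
def Memory.point (mem : Memory) (base t : ℕ) : ℝ × ℝ :=
  (mem.real (base + 2 * t), mem.real (base + 2 * t + 1))

/-! ### The decomposition tree over time

The nodes of the tree over `n` events are pairs `(k, b)`: the node of height `k` and position `b`
covers the events `t` with `b * 2 ^ k ≤ t < (b + 1) * 2 ^ k` (cut off at `n`).  The leaves are the
nodes `(0, t)`, the root is `(⌈log₂ n⌉, 0)`, and the children of `(k + 1, b)` are `(k, 2 * b)` and,
unless its range is empty, `(k, 2 * b + 1)`. -/

/-- `(k, b)` is a node of the tree over `n` events. -/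
def IsNode (n k b : ℕ) : Prop := k ≤ Nat.clog 2 n ∧ b * 2 ^ k < n

/-- The canonical subset of the node `(k, b)`: the points of the events that it covers. -/
def canonicalSubset {n : ℕ} (p : Fin n → ℝ × ℝ) (k b : ℕ) : Set (ℝ × ℝ) :=
  p '' {t | b * 2 ^ k ≤ (t : ℕ) ∧ (t : ℕ) < (b + 1) * 2 ^ k}

open Classical in
/-- The pointer to the node `(k, b)`, or the null pointer `0` if there is no such node. -/
noncomputable def pointer (n : ℕ) (addr : ℕ → ℕ → ℕ) (k b : ℕ) : ℕ :=
  if IsNode n k b then addr k b else 0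

/-- The record of the node `(k, b)`, at address `addr k b`, consists of the pointers to its parent,
its left child, its right child, its predecessor and its successor on its level (null where there is
no such node), the address and the length of the array of its hull vertices, and the position of the
lexicographically smallest point in that array. -/
structure IsRecord {n : ℕ} (mem : Memory) (p : Fin n → ℝ × ℝ) (addr : ℕ → ℕ → ℕ) (k b : ℕ) :
    Prop where
  addr_pos : 0 < addr k b
  parent : mem.nat (addr k b) = pointer n addr (k + 1) (b / 2)
  left : mem.nat (addr k b + 1) = if k = 0 then 0 else pointer n addr (k - 1) (2 * b)
  right : mem.nat (addr k b + 2) = if k = 0 then 0 else pointer n addr (k - 1) (2 * b + 1)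
  prev : mem.nat (addr k b + 3) = if b = 0 then 0 else pointer n addr k (b - 1)
  next : mem.nat (addr k b + 4) = pointer n addr k (b + 1)
  hull : IsClockwiseHull (canonicalSubset p k b) (mem.nat (addr k b + 6))
    (mem.point (mem.nat (addr k b + 5))) (mem.nat (addr k b + 7))

/-- The memory holds the decomposition tree of the points `p`, with the array of the leaves at
address `A` of the memory of natural numbers. -/
def StoresDecomposition {n : ℕ} (mem : Memory) (A : ℕ) (p : Fin n → ℝ × ℝ) : Prop :=
  ∃ addr : ℕ → ℕ → ℕ,
    (∀ t : Fin n, mem.nat (A + t) = addr 0 t) ∧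
    ∀ k b, IsNode n k b → IsRecord mem p addr k b

/-! ### Tangent queries -/

/-- `L` is a tangent (a supporting line) of `K`: it meets `K`, and `K` lies on one side of it. -/
def IsTangent (K L : Set (ℝ × ℝ)) : Prop :=
  ∃ a b c : ℝ, (a ≠ 0 ∨ b ≠ 0) ∧ L = {z | a * z.1 + b * z.2 = c} ∧
    (∀ z ∈ K, c ≤ a * z.1 + b * z.2) ∧ (L ∩ K).Nonempty

/-- The line through two points. -/
def lineThrough (q u : ℝ × ℝ) : Set (ℝ × ℝ) := (line[ℝ, q, u] : Set (ℝ × ℝ))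

/-- The registers at the start of a query `(i, j, q)`. -/
noncomputable def queryRegs (A i j : ℕ) (q : ℝ × ℝ) : Regs where
  nat r := if r = 0 then A else if r = 1 then i else if r = 2 then j else 0
  real r := if r = 0 then q.1 else if r = 1 then q.2 else 0

/-- The final registers answer the tangent query for `K` and `q`: the flag in register `0` is `0` (the
exception) if `q` is in `K`; otherwise it is `1`, and the real registers `0, 1` and `2, 3` hold points
`u, v` of `K` such that the tangents of `K` through `q` are the lines `qu` and `qv`. -/
def AnswersTangentQuery (K : Set (ℝ × ℝ)) (q : ℝ × ℝ) (s : Regs) : Prop :=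
  (q ∈ K ∧ s.nat 0 = 0) ∨
  (q ∉ K ∧ s.nat 0 = 1 ∧
    (s.real 0, s.real 1) ∈ K ∧ (s.real 2, s.real 3) ∈ K ∧
    {L | q ∈ L ∧ IsTangent K L} =
      {lineThrough q (s.real 0, s.real 1), lineThrough q (s.real 2, s.real 3)})

end WindowHull

/-! Put the query point `q` at the origin and look at the directions of the vectors `z - q`. The
lexicographic order cuts the nonzero vectors into two opposite half-planes, each consisting of an
open half-plane and half of its boundary line. Inside one of them the sign of `cross` is a total
preorder of directions (`cross_nonneg_trans`), so least and greatest directions make sense there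
without angles, and degenerate positions need no separate treatment. Proofs about finitely many such
vectors use one linear functional `x + ε y`, positive on all of them for small `ε`
(`LexPos.eventually`).

A stored hull splits at its lexicographic maximum and minimum into two chains; the second becomes
like the first after reflection in `q`. Along a lexicographically decreasing clockwise chain, the
positive vectors form an initial piece on which the direction first falls and then rises, and on the
negative vectors it first rises and then falls. So the extreme directions of either piece occur at
its ends or at one turning point, and three binary searches give six candidates that bound all
directions of the chain (`ClockwiseChain.spans`). If `q` is itself on the chain, the zero vector is
among the candidates.

The window is covered by tree nodes, at most two per level, found by climbing from its two end
leaves. The program keeps only the least and greatest directions `a`, `b` of the positive candidates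
and `c`, `d` of the negative ones. The hull of the window lies in `q` plus the convex hull of the
directions these bound, and `tangents_of_extremes` decides from them: if the range of `-c`, `-d` is
strictly below or above that of `a`, `b`, or one side is empty, all directions lie in an open
half-plane and the two outermost ones are the tangents; if the ranges meet, two opposite vectors
exhibit `q` as a convex combination of points of the hull.

With `w < 2 ^ M` there are at most `M` levels, and each costs a constant number of binary searches
in arrays of length at most `2 ^ M`, hence `O(M ^ 2)` steps. The correctness statements `Wp` carry
the step count. The candidate set `F` exists only in the proofs; `Tracks` links it to the registers.
-/

namespace WindowHull

open Filter Topology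

/-! ### Planar vectors and the lexicographic half-plane -/

/-- The determinant of two vectors of the plane. -/
def cross (u v : ℝ × ℝ) : ℝ := u.1 * v.2 - u.2 * v.1

/-- Lexicographically positive vectors. -/
def LexPos (u : ℝ × ℝ) : Prop := 0 < u.1 ∨ (u.1 = 0 ∧ 0 < u.2)

theorem cross_swap (u v : ℝ × ℝ) : cross u v = -cross v u := by simp only [cross]; ring

theorem cross_self (u : ℝ × ℝ) : cross u u = 0 := by simp only [cross]; ring

theorem cross_neg_neg (u v : ℝ × ℝ) : cross (-u) (-v) = cross u v := by simp [cross]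

theorem cross_neg_left (u v : ℝ × ℝ) : cross (-u) v = -cross u v := by simp [cross]; ring

theorem cross_neg_right (u v : ℝ × ℝ) : cross u (-v) = -cross u v := by simp [cross]; ring

theorem LexPos.add {u v : ℝ × ℝ} (hu : LexPos u) (hv : LexPos v) : LexPos (u + v) := by
  simp only [LexPos, Prod.fst_add, Prod.snd_add] at *
  rcases hu with hu | ⟨hu, hu'⟩ <;> rcases hv with hv | ⟨hv, hv'⟩
  · left; linarith
  · left; linarith
  · left; linarith
  · right; constructor <;> linarith

theorem not_lexPos_zero : ¬ LexPos 0 := by simp [LexPos]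

theorem LexPos.ne_zero {u : ℝ × ℝ} (hu : LexPos u) : u ≠ 0 := by
  rintro rfl; exact not_lexPos_zero hu

theorem LexPos.not_neg {u : ℝ × ℝ} (hu : LexPos u) : ¬ LexPos (-u) := fun h =>
  not_lexPos_zero (by simpa using hu.add h)

theorem lexPos_trichotomy (u : ℝ × ℝ) : LexPos u ∨ u = 0 ∨ LexPos (-u) := by
  obtain ⟨x, y⟩ := u
  simp only [LexPos, Prod.neg_mk, Prod.mk_eq_zero]
  rcases lt_trichotomy x 0 with h | h | h
  · right; right; left; linarith
  · rcases lt_trichotomy y 0 with h' | h' | h'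
    · right; right; right; constructor <;> linarith
    · right; left; exact ⟨h, h'⟩
    · left; right; exact ⟨h, h'⟩
  · left; left; exact h

/-- A lexicographically positive vector is positive under `x + ε y` for all small `ε`. -/
theorem LexPos.eventually {u : ℝ × ℝ} (hu : LexPos u) :
    ∀ᶠ ε in 𝓝[>] (0 : ℝ), 0 < u.1 + ε * u.2 := by
  rcases hu with h | ⟨h, h'⟩
  · have : Tendsto (fun ε : ℝ => u.1 + ε * u.2) (𝓝[>] 0) (𝓝 (u.1 + 0 * u.2)) :=
      ((continuous_const.add (continuous_id.mul continuous_const)).tendsto 0).mono_left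
        nhdsWithin_le_nhds
    exact this.eventually (lt_mem_nhds (by simpa using h))
  · filter_upwards [self_mem_nhdsWithin] with ε hε
    rw [h, zero_add]
    exact mul_pos hε h'

/-- For a linear functional `f` one has `f v * (u × w) = f u * (v × w) + f w * (u × v)`. Choosing `f
= x + ε y` positive on all three vectors transfers the signs. Transitivity fails on the whole plane,
which is why directions are compared only within one half-plane. -/
theorem cross_nonneg_trans {u v w : ℝ × ℝ} (hu : LexPos u) (hv : LexPos v) (hw : LexPos w)
    (huv : 0 ≤ cross u v) (hvw : 0 ≤ cross v w) : 0 ≤ cross u w := by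
  obtain ⟨ε, h1, h2, h3⟩ := (hu.eventually.and (hv.eventually.and hw.eventually)).exists
  have key : (v.1 + ε * v.2) * cross u w
      = (u.1 + ε * u.2) * cross v w + (w.1 + ε * w.2) * cross u v := by
    simp only [cross]; ring
  have : 0 ≤ (v.1 + ε * v.2) * cross u w := by rw [key]; positivity
  exact nonneg_of_mul_nonneg_right this h2

theorem cross_nonneg_trans_neg {u v w : ℝ × ℝ} (hu : LexPos (-u)) (hv : LexPos (-v))
    (hw : LexPos (-w)) (huv : 0 ≤ cross u v) (hvw : 0 ≤ cross v w) : 0 ≤ cross u w := by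
  rw [← cross_neg_neg] at *
  exact cross_nonneg_trans hu hv hw huv hvw

/-- Along a lexicographically decreasing clockwise chain the direction first decreases. -/
theorem cross_pos_of_descending {u v w : ℝ × ℝ} (hw : LexPos w) (hvw : LexPos (v - w))
    (huv : LexPos (u - v)) (ho : orient u v w < 0) (h : 0 ≤ cross u v) : 0 < cross v w := by
  obtain ⟨ε, h1, h2, h3⟩ := (hw.eventually.and (hvw.eventually.and huv.eventually)).exists
  simp only [Prod.fst_sub, Prod.snd_sub] at h2 h3
  -- With `f = x + ε y` this is `f (u - v) * (v × w) = f (v - w) * (u × v) - f v * orient u v w`,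
  -- and all the values of `f` are positive.
  have key : (u.1 - v.1 + ε * (u.2 - v.2)) * cross v w
      = (v.1 - w.1 + ε * (v.2 - w.2)) * cross u v - (v.1 + ε * v.2) * orient u v w := by
    simp only [cross, orient]; ring
  have h4 : 0 < v.1 + ε * v.2 := by linarith
  have : 0 < (u.1 - v.1 + ε * (u.2 - v.2)) * cross v w := by
    rw [key]
    have := mul_nonneg h2.le h
    have := mul_neg_of_pos_of_neg h4 ho
    linarith
  exact pos_of_mul_pos_right this h3.le

/-- Along a lexicographically increasing clockwise chain the direction first increases. -/
theorem cross_neg_of_ascending {u v w : ℝ × ℝ} (hu : LexPos u) (hvu : LexPos (v - u))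
    (hwv : LexPos (w - v)) (ho : orient u v w < 0) (h : cross u v ≤ 0) : cross v w < 0 := by
  obtain ⟨ε, h1, h2, h3⟩ := (hu.eventually.and (hvu.eventually.and hwv.eventually)).exists
  simp only [Prod.fst_sub, Prod.snd_sub] at h2 h3
  have key : (v.1 - u.1 + ε * (v.2 - u.2)) * cross v w
      = (w.1 - v.1 + ε * (w.2 - v.2)) * cross u v + (v.1 + ε * v.2) * orient u v w := by
    simp only [cross, orient]; ring
  have h4 : 0 < v.1 + ε * v.2 := by linarith
  have : (v.1 - u.1 + ε * (v.2 - u.2)) * cross v w < 0 := by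
    rw [key]
    have := mul_nonpos_of_nonneg_of_nonpos h3.le h
    have := mul_neg_of_pos_of_neg h4 ho
    linarith
  by_contra hc
  push Not at hc
  have := mul_nonneg h2.le hc
  linarith

/-- Two vertices on the clockwise way from the extreme point `o` to the opposite extreme point `z`
appear in lexicographic order. -/
theorem lexPos_sub_of_clockwise {o a b z : ℝ × ℝ} (hob : LexPos (o - b)) (haz : LexPos (a - z))
    (h1 : orient o a b < 0) (h3 : orient o b z < 0) (h4 : orient a b z < 0) : LexPos (a - b) := by
  have main : ∀ ε : ℝ, 0 < (o - b).1 + ε * (o - b).2 → 0 < (a - z).1 + ε * (a - z).2 →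
      0 ≤ (b - a).1 + ε * (b - a).2 → False := by
    intro ε e1 e2 e3
    simp only [Prod.fst_sub, Prod.snd_sub] at e1 e2 e3
    -- The affine dependence of the four points, evaluated under `x + ε y`. If `b` were not below
    -- `a`, all three terms would be nonpositive and the first strictly negative.
    have key : (o.1 - b.1 + ε * (o.2 - b.2)) * orient a b z
        + (b.1 - a.1 + ε * (b.2 - a.2)) * orient o b z
        + (b.1 - z.1 + ε * (b.2 - z.2)) * orient o a b = 0 := by
      simp only [orient]; ring
    have i1 := mul_neg_of_pos_of_neg e1 h4
    have i2 := mul_nonpos_of_nonneg_of_nonpos e3 h3.le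
    have i3 : (b.1 - z.1 + ε * (b.2 - z.2)) * orient o a b < 0 :=
      mul_neg_of_pos_of_neg (by linarith) h1
    linarith
  rcases lexPos_trichotomy (a - b) with h | h | h
  · exact h
  · obtain ⟨ε, e1, e2⟩ := (hob.eventually.and haz.eventually).exists
    refine (main ε e1 e2 ?_).elim
    rw [sub_eq_zero] at h
    simp [h]
  · obtain ⟨ε, e1, e2, e3⟩ := (hob.eventually.and (haz.eventually.and h.eventually)).exists
    rw [neg_sub] at e3
    exact (main ε e1 e2 e3.le).elim

theorem toLex_le_iff (u v : ℝ × ℝ) : toLex u ≤ toLex v ↔ u = v ∨ LexPos (v - u) := by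
  obtain ⟨a, b⟩ := u
  obtain ⟨c, d⟩ := v
  rw [Prod.Lex.toLex_le_toLex]
  simp only [LexPos, Prod.mk_sub_mk, Prod.mk.injEq, sub_pos, sub_eq_zero, le_iff_lt_or_eq (a := b)]
  constructor
  · rintro (h | ⟨h, h' | h'⟩)
    · exact .inr (.inl h)
    · exact .inr (.inr ⟨h.symm, h'⟩)
    · exact .inl ⟨h, h'⟩
  · rintro (⟨h, h'⟩ | h | ⟨h, h'⟩)
    · exact .inr ⟨h, .inr h'⟩
    · exact .inl h
    · exact .inr ⟨h.symm, .inl h'⟩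

/-! ### Directions spanned by finitely many vectors -/

/-- The direction of `x` lies between two directions of `F` in one of the two lexicographic
half-planes. -/
def Spans (F : Set (ℝ × ℝ)) (x : ℝ × ℝ) : Prop :=
  ∃ a ∈ F, ∃ b ∈ F, ((LexPos a ∧ LexPos b ∧ LexPos x) ∨ (LexPos (-a) ∧ LexPos (-b) ∧ LexPos (-x))) ∧
    0 ≤ cross a x ∧ cross b x ≤ 0

theorem Spans.mono {F G : Set (ℝ × ℝ)} (h : F ⊆ G) {x : ℝ × ℝ} : Spans F x → Spans G x := by
  rintro ⟨a, ha, b, hb, h'⟩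
  exact ⟨a, h ha, b, h hb, h'⟩

theorem Spans.neg {F : Set (ℝ × ℝ)} {x : ℝ × ℝ} : Spans F x → Spans (-F) (-x) := by
  rintro ⟨a, ha, b, hb, h, h1, h2⟩
  refine ⟨-a, by simpa using ha, -b, by simpa using hb, ?_, ?_, ?_⟩
  · simp only [neg_neg]; exact h.symm
  · rwa [cross_neg_neg]
  · rwa [cross_neg_neg]

/-- `a` and `b` are the least and the greatest direction among the lexicographically positive vectors
of `F`, and are zero if there are none. -/
def Extremes (F : Set (ℝ × ℝ)) (a b : ℝ × ℝ) : Prop :=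
  (a = 0 ∧ b = 0 ∧ ∀ x ∈ F, ¬ LexPos x) ∨
  (a ∈ F ∧ b ∈ F ∧ LexPos a ∧ LexPos b ∧ ∀ x ∈ F, LexPos x → 0 ≤ cross a x ∧ cross b x ≤ 0)

theorem Extremes.insert_of_not {F : Set (ℝ × ℝ)} {a b x : ℝ × ℝ} (h : Extremes F a b)
    (hx : ¬ LexPos x) : Extremes (insert x F) a b := by
  rcases h with ⟨h1, h2, h3⟩ | ⟨h1, h2, h3, h4, h5⟩
  · refine .inl ⟨h1, h2, ?_⟩
    rintro y (rfl | hy)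
    exacts [hx, h3 y hy]
  · refine .inr ⟨.inr h1, .inr h2, h3, h4, ?_⟩
    rintro y (rfl | hy) hy'
    exacts [(hx hy').elim, h5 y hy hy']

-- Ties are decided in favour of the new vector. Since `cross 0 x = 0`, the zero vectors that stand
-- for an empty side are then replaced by the first positive vector with no test of their own.
open Classical in
theorem Extremes.insert {F : Set (ℝ × ℝ)} {a b x : ℝ × ℝ} (h : Extremes F a b) (hx : LexPos x) :
    Extremes (insert x F) (if cross a x ≤ 0 then x else a) (if 0 ≤ cross b x then x else b) := by
  right
  rcases h with ⟨rfl, rfl, h3⟩ | ⟨h1, h2, h3, h4, h5⟩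
  · have h0 : cross 0 x = 0 := by simp [cross]
    simp only [h0, le_refl, if_true]
    refine ⟨.inl rfl, .inl rfl, hx, hx, ?_⟩
    rintro y (rfl | hy) hy'
    · simp [cross_self]
    · exact (h3 y hy hy').elim
  · refine ⟨?_, ?_, ?_, ?_, ?_⟩
    · split_ifs; exacts [.inl rfl, .inr h1]
    · split_ifs; exacts [.inl rfl, .inr h2]
    · split_ifs <;> assumption
    · split_ifs <;> assumption
    · rintro y (rfl | hy) hy'
      · constructor
        · split_ifs with h
          · simp [cross_self]
          · linarith
        · split_ifs with h
          · simp [cross_self]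
          · linarith
      · obtain ⟨h6, h7⟩ := h5 y hy hy'
        constructor
        · split_ifs with h
          · exact cross_nonneg_trans hx h3 hy' (by rw [cross_swap]; linarith) h6
          · exact h6
        · split_ifs with h
          · have := cross_nonneg_trans hy' h4 hx (by rw [cross_swap]; linarith) h
            rw [cross_swap]; linarith
          · exact h7

/-- Transitivity within the half-plane passes from the vectors of `F` to every direction between
them. So it suffices to feed candidates that span the hull rather than all its vertices. -/
theorem Extremes.cross_of_spans {F : Set (ℝ × ℝ)} {a b x : ℝ × ℝ} (h : Extremes F a b)
    (hx : Spans F x) (hp : LexPos x) : LexPos a ∧ LexPos b ∧ 0 ≤ cross a x ∧ cross b x ≤ 0 := by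
  obtain ⟨c, hc, d, hd, h', h1, h2⟩ := hx
  obtain ⟨hc', hd', -⟩ := h'.resolve_right (fun h => hp.not_neg h.2.2)
  rcases h with ⟨-, -, h3⟩ | ⟨-, -, h3, h4, h5⟩
  · exact (h3 c hc hc').elim
  · refine ⟨h3, h4, cross_nonneg_trans h3 hc' hp (h5 c hc hc').1 h1, ?_⟩
    have := cross_nonneg_trans hp hd' h4 (by rw [cross_swap]; linarith)
      (by rw [cross_swap]; linarith [(h5 d hd hd').2])
    rw [cross_swap]; linarith

/-! ### Clockwise chains -/

/-- `w lo, …, w hi` is lexicographically decreasing and turns clockwise. -/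
structure ClockwiseChain (w : ℕ → ℝ × ℝ) (lo hi : ℕ) : Prop where
  desc : ∀ a b, lo ≤ a → a < b → b ≤ hi → LexPos (w a - w b)
  clockwise : ∀ a b c, lo ≤ a → a < b → b < c → c ≤ hi → orient (w a) (w b) (w c) < 0

/-- The result of a binary search in `lo, …, hi` for the first index that fails `P`. -/
def IsCut (P : ℕ → Prop) (lo hi r : ℕ) : Prop :=
  lo ≤ r ∧ r ≤ hi ∧ (r = lo ∨ P (r - 1)) ∧ (r = hi ∨ ¬ P r)

namespace ClockwiseChain

variable {w : ℕ → ℝ × ℝ} {lo hi : ℕ}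

theorem lexPos_of_le (h : ClockwiseChain w lo hi) {a b : ℕ} (ha : lo ≤ a) (hab : a ≤ b)
    (hb : b ≤ hi) (hw : LexPos (w b)) : LexPos (w a) := by
  rcases hab.eq_or_lt with rfl | hab
  · exact hw
  · simpa using (h.desc a b ha hab hb).add hw

theorem neg_lexPos_of_le (h : ClockwiseChain w lo hi) {a b : ℕ} (ha : lo ≤ a) (hab : a ≤ b)
    (hb : b ≤ hi) (hw : LexPos (-w a)) : LexPos (-w b) := by
  rcases hab.eq_or_lt with rfl | hab
  · exact hw
  · have := (h.desc a b ha hab hb).add hw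
    rwa [show w a - w b + -w a = -w b by abel] at this

theorem cross_pos (h : ClockwiseChain w lo hi) {a b c : ℕ} (ha : lo ≤ a) (hab : a < b) (hbc : b < c)
    (hc : c ≤ hi) (hp : LexPos (w c)) (h0 : 0 ≤ cross (w a) (w b)) : 0 < cross (w b) (w c) :=
  cross_pos_of_descending hp (h.desc b c (by omega) hbc hc) (h.desc a b ha hab (by omega))
    (h.clockwise a b c ha hab hbc hc) h0

theorem cross_neg (h : ClockwiseChain w lo hi) {a b c : ℕ} (ha : lo ≤ a) (hab : a < b) (hbc : b < c)
    (hc : c ≤ hi) (hp : LexPos (-w a)) (h0 : cross (w a) (w b) ≤ 0) : cross (w b) (w c) < 0 := by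
  rw [← cross_neg_neg] at h0 ⊢
  refine cross_neg_of_ascending hp ?_ ?_ ?_ h0
  · rw [neg_sub_neg]; exact h.desc a b ha hab (by omega)
  · rw [neg_sub_neg]; exact h.desc b c (by omega) hbc hc
  · have := h.clockwise a b c ha hab hbc hc
    simp only [orient, Prod.fst_neg, Prod.snd_neg] at this ⊢
    linarith

/-- The index with the least direction in the positive part. -/
theorem cross_nonneg_of_isCut (h : ClockwiseChain w lo hi) {r t : ℕ}
    (hr : IsCut (fun t => LexPos (w (t + 1)) ∧ cross (w t) (w (t + 1)) < 0) lo hi r)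
    (ht : lo ≤ t) (ht' : t ≤ hi) (hp : LexPos (w t)) :
    LexPos (w r) ∧ 0 ≤ cross (w r) (w t) := by
  obtain ⟨h1, h2, h3, h4⟩ := hr
  have hrp : LexPos (w r) := by
    rcases h1.eq_or_lt with rfl | h1
    · exact h.lexPos_of_le le_rfl ht ht' hp
    · have := (h3.resolve_left (by omega)).1
      rwa [show r - 1 + 1 = r by omega] at this
  refine ⟨hrp, ?_⟩
  rcases lt_trichotomy t r with hlt | rfl | hlt
  -- The step into `r` falls. Had the direction risen, or stayed, from `t` to `r - 1`, `cross_pos`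
  -- would force it to rise on the step into `r`. Thus a local turning point is global, and `IsCut`
  -- need not assume a monotone predicate.
  · obtain ⟨-, h5⟩ := h3.resolve_left (by omega)
    obtain ⟨r, rfl⟩ : ∃ r', r = r' + 1 := ⟨r - 1, by omega⟩
    simp only [Nat.add_sub_cancel] at h5
    have h6 : 0 ≤ cross (w (r + 1)) (w r) := by rw [cross_swap]; linarith
    rcases (show t ≤ r by omega).eq_or_lt with rfl | hlt'
    · exact h6
    · refine cross_nonneg_trans hrp (h.lexPos_of_le (by omega) (by omega) h2 hrp) hp h6 ?_
      by_contra hc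
      have := h.cross_pos ht hlt' (by omega) h2 hrp (by rw [cross_swap]; linarith)
      linarith
  · rw [cross_self]
  · have hp' : LexPos (w (r + 1)) := h.lexPos_of_le (by omega) hlt ht' hp
    have h5 : 0 ≤ cross (w r) (w (r + 1)) := by
      by_contra hc
      exact (h4.resolve_left (by omega)) ⟨hp', not_le.1 hc⟩
    rcases (show r + 1 ≤ t from hlt).eq_or_lt with rfl | hlt'
    · exact h5
    · exact cross_nonneg_trans hrp hp' hp h5 (h.cross_pos h1 (by omega) hlt' ht' hp h5).le

/-- The index with the greatest direction in the negative part. -/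
theorem cross_nonpos_of_isCut (h : ClockwiseChain w lo hi) (h0 : ∀ t, lo ≤ t → t ≤ hi → w t ≠ 0)
    {r t : ℕ} (hr : IsCut (fun t => LexPos (w t) ∨ 0 < cross (w t) (w (t + 1))) lo hi r)
    (ht : lo ≤ t) (ht' : t ≤ hi) (hp : LexPos (-w t)) :
    LexPos (-w r) ∧ cross (w r) (w t) ≤ 0 := by
  obtain ⟨h1, h2, h3, h4⟩ := hr
  have hrp : LexPos (-w r) := by
    rcases h2.eq_or_lt with rfl | h2'
    · exact h.neg_lexPos_of_le ht ht' le_rfl hp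
    · have := h4.resolve_left (by omega)
      push Not at this
      exact ((lexPos_trichotomy _).resolve_left this.1).resolve_left (h0 r h1 h2)
  refine ⟨hrp, ?_⟩
  rcases lt_trichotomy t r with hlt | rfl | hlt
  · have h5 := h3.resolve_left (by omega)
    obtain ⟨r, rfl⟩ : ∃ r', r = r' + 1 := ⟨r - 1, by omega⟩
    simp only [Nat.add_sub_cancel] at h5
    have hp' : LexPos (-w r) := h.neg_lexPos_of_le ht (by omega) (by omega) hp
    have h6 := h5.resolve_left (fun h => h.not_neg hp')
    rw [cross_swap, neg_nonpos]
    rcases (show t ≤ r by omega).eq_or_lt with rfl | hlt'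
    · exact h6.le
    · refine cross_nonneg_trans_neg hp hp' hrp ?_ h6.le
      by_contra hc
      have := h.cross_neg ht hlt' (by omega) h2 hp (by linarith)
      linarith
  · rw [cross_self]
  · have h5 := h4.resolve_left (by omega)
    push Not at h5
    have hp' : LexPos (-w (r + 1)) := h.neg_lexPos_of_le h1 (by omega) (by omega) hrp
    rcases (show r + 1 ≤ t from hlt).eq_or_lt with rfl | hlt'
    · exact h5.2
    · have h6 := h.cross_neg h1 (by omega) hlt' ht' hrp h5.2
      have := cross_nonneg_trans_neg hp hp' hrp (by rw [cross_swap]; linarith)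
        (by rw [cross_swap]; linarith)
      rw [cross_swap]; linarith

/-- Six candidates of a chain span all its directions. -/
theorem spans (h : ClockwiseChain w lo hi) {F : Set (ℝ × ℝ)} {r₁ r₂ r₃ : ℕ}
    (h1 : IsCut (fun t => LexPos (w (t + 1)) ∧ cross (w t) (w (t + 1)) < 0) lo hi r₁)
    (h2 : IsCut (fun t => LexPos (w (t + 1))) lo hi r₂)
    (h3 : IsCut (fun t => LexPos (w t) ∨ 0 < cross (w t) (w (t + 1))) lo hi r₃)
    (flo : w lo ∈ F) (fhi : w hi ∈ F) (f1 : w r₁ ∈ F) (f2 : w r₂ ∈ F)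
    (f2' : w (if r₂ < hi then r₂ + 1 else r₂) ∈ F) (f3 : w r₃ ∈ F) :
    0 ∈ F ∨ ∀ t, lo ≤ t → t ≤ hi → Spans F (w t) := by
  obtain ⟨i1, i2, i3, i4⟩ := h2
  have hpos : ∀ t, lo ≤ t → t ≤ hi → LexPos (w t) → t ≤ r₂ ∧ LexPos (w r₂) := by
    intro t ht ht' hp
    refine ⟨?_, ?_⟩
    · by_contra hc
      exact (i4.resolve_left (by omega)) (h.lexPos_of_le (by omega) (by omega) ht' hp)
    · rcases i1.eq_or_lt with rfl | i1
      · exact h.lexPos_of_le le_rfl ht ht' hp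
      · have : LexPos (w (r₂ - 1 + 1)) := i3.resolve_left (by omega)
        rwa [show r₂ - 1 + 1 = r₂ by omega] at this
  -- The first nonpositive index is `lo` or `r₂ + 1`, and both are candidates. A zero vector of the
  -- chain must sit there, because everything before it is strictly positive.
  have hfirst : ∀ t, lo ≤ t → t ≤ hi → ¬ LexPos (w t) →
      ∃ e, lo ≤ e ∧ e ≤ t ∧ w e ∈ F ∧ ¬ LexPos (w e) := by
    intro t ht ht' hp
    by_cases hl : LexPos (w lo)
    · obtain ⟨j1, j2⟩ := hpos lo le_rfl (by omega) hl
      have j3 : r₂ < t := by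
        by_contra hc
        exact hp (h.lexPos_of_le ht (by omega) i2 j2)
      rw [if_pos (by omega)] at f2'
      exact ⟨r₂ + 1, by omega, by omega, f2', i4.resolve_left (by omega)⟩
    · exact ⟨lo, le_rfl, ht, flo, hl⟩
  by_cases hz : ∃ t, lo ≤ t ∧ t ≤ hi ∧ w t = 0
  · left
    obtain ⟨t, ht, ht', hz⟩ := hz
    obtain ⟨e, j1, j2, j3, j4⟩ := hfirst t ht ht' (by rw [hz]; exact not_lexPos_zero)
    rcases j2.eq_or_lt with rfl | j2
    · rwa [hz] at j3
    · have := h.desc e t j1 j2 ht'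
      rw [hz, sub_zero] at this
      exact (j4 this).elim
  right
  push Not at hz
  intro t ht ht'
  rcases lexPos_trichotomy (w t) with hp | hp | hp
  · obtain ⟨j1, j2⟩ := h.cross_nonneg_of_isCut h1 ht ht' hp
    obtain ⟨j3, j4⟩ := hpos t ht ht' hp
    have hlo := h.lexPos_of_le le_rfl ht ht' hp
    -- The greatest positive direction is at an end of the positive piece: once the direction at `t`
    -- exceeds that at `lo`, it keeps rising up to the last positive index `r₂`.
    by_cases hc : cross (w lo) (w t) ≤ 0
    · exact ⟨_, f1, _, flo, .inl ⟨j1, hlo, hp⟩, j2, hc⟩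
    · refine ⟨_, f1, _, f2, .inl ⟨j1, j4, hp⟩, j2, ?_⟩
      rcases j3.eq_or_lt with rfl | j3
      · rw [cross_self]
      · rcases ht.eq_or_lt with rfl | ht
        · rw [cross_self] at hc; exact (hc le_rfl).elim
        · have := h.cross_pos le_rfl ht j3 i2 j4 (by linarith)
          rw [cross_swap]; linarith
  · exact (hz t ht ht' hp).elim
  · obtain ⟨j1, j2⟩ := h.cross_nonpos_of_isCut hz h3 ht ht' hp
    obtain ⟨e, j3, j4, j5, j6⟩ := hfirst t ht ht' (fun h => h.not_neg hp)
    have he := ((lexPos_trichotomy _).resolve_left j6).resolve_left (hz e j3 (by omega))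
    have hhi := h.neg_lexPos_of_le ht ht' le_rfl hp
    -- Dually, the least negative direction is at an end of the negative piece: once the direction
    -- has dropped below that at `e`, it keeps falling up to `hi`.
    by_cases hc : 0 ≤ cross (w e) (w t)
    · exact ⟨_, j5, _, f3, .inr ⟨he, j1, hp⟩, hc, j2⟩
    · refine ⟨_, fhi, _, f3, .inr ⟨hhi, j1, hp⟩, ?_, j2⟩
      rcases j4.eq_or_lt with rfl | j4
      · rw [cross_self] at hc; exact (hc le_rfl).elim
      · rcases ht'.eq_or_lt with rfl | ht'
        · rw [cross_self]
        · have := h.cross_neg j3 j4 ht' le_rfl he (by linarith)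
          rw [cross_swap]; linarith

end ClockwiseChain

/-! ### Stored hulls -/

theorem orient_rotate (a b c : ℝ × ℝ) : orient b c a = orient a b c := by
  simp only [orient]; ring

theorem orient_neg_sub (a b c q : ℝ × ℝ) :
    orient (-(a - q)) (-(b - q)) (-(c - q)) = orient a b c := by
  simp only [orient, Prod.fst_neg, Prod.snd_neg, Prod.fst_sub, Prod.snd_sub]; ring

theorem orient_sub (a b c q : ℝ × ℝ) : orient (a - q) (b - q) (c - q) = orient a b c := by
  simp only [orient, Prod.fst_sub, Prod.snd_sub]; ring

namespace IsClockwiseHull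

variable {S : Set (ℝ × ℝ)} {h : ℕ} {v : ℕ → ℝ × ℝ} {m : ℕ}

theorem mem (H : IsClockwiseHull S h v m) {t : ℕ} (ht : t < h) : v t ∈ S := by
  have : v t ∈ Set.extremePoints ℝ (convexHull ℝ S) := by
    rw [← H.vertices]; exact ⟨t, ht, rfl⟩
  exact extremePoints_convexHull_subset this

/-- Krein–Milman for the compact hull of a finite set; the closure is superfluous because there are
finitely many extreme points. -/
theorem subset_convexHull (H : IsClockwiseHull S h v m) (hS : S.Finite) :
    S ⊆ convexHull ℝ (v '' {t | t < h}) := by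
  have h1 := closure_convexHull_extremePoints (hS.isCompact_convexHull ℝ) (convex_convexHull ℝ S)
  rw [← H.vertices] at h1
  have h2 : (v '' {t | t < h}).Finite := (Set.finite_lt_nat h).image v
  rw [(h2.isClosed_convexHull ℝ).closure_eq] at h1
  rw [h1]
  exact _root_.subset_convexHull ℝ S

/-- Bounds the range of the binary searches by the number of points that a node covers. -/
theorem ncard_le (H : IsClockwiseHull S h v m) (hS : S.Finite) : h ≤ S.ncard := by
  have h1 : Set.InjOn v {t | t < h} := by
    intro a ha b hb hab
    rcases lt_trichotomy a b with hlt | hlt | hlt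
    · exact (H.distinct a b hlt hb hab).elim
    · exact hlt
    · exact (H.distinct b a hlt ha hab.symm).elim
  have h2 : v '' {t | t < h} ⊆ S := by
    rintro _ ⟨t, ht, rfl⟩
    exact H.mem ht
  calc h = ({t | t < h} : Set ℕ).ncard := by
        rw [show ({t | t < h} : Set ℕ) = ↑(Finset.range h) by ext; simp, Set.ncard_coe_finset,
          Finset.card_range]
    _ = (v '' {t | t < h}).ncard := h1.ncard_image.symm
    _ ≤ S.ncard := Set.ncard_le_ncard h2 hS

theorem lexPos_first (H : IsClockwiseHull S h v m) {t : ℕ} (h0 : 0 < t) (ht : t < h) :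
    LexPos (v 0 - v t) :=
  ((toLex_le_iff _ _).1 (H.first_max _ (H.mem ht))).resolve_left
    fun e => H.distinct 0 t h0 ht e.symm

theorem lexPos_min (H : IsClockwiseHull S h v m) {t : ℕ} (h0 : t ≠ m) (ht : t < h) :
    LexPos (v t - v m) := by
  refine ((toLex_le_iff _ _).1 (H.min_le _ (H.mem ht))).resolve_left fun e => ?_
  rcases h0.lt_or_gt with h0 | h0
  · exact H.distinct t m h0 H.min_lt e.symm
  · exact H.distinct m t h0 ht e

theorem lower (H : IsClockwiseHull S h v m) (q : ℝ × ℝ) :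
    ClockwiseChain (fun t => v t - q) 0 m where
  desc a b _ hab hb := by
    have hm := H.min_lt
    simp only [sub_sub_sub_cancel_right]
    rcases Nat.eq_zero_or_pos a with rfl | ha
    · exact H.lexPos_first hab (by omega)
    rcases hb.eq_or_lt with rfl | hb
    · exact H.lexPos_min hab.ne (by omega)
    exact lexPos_sub_of_clockwise (H.lexPos_first (by omega) (by omega))
      (H.lexPos_min (by omega) (by omega)) (H.clockwise 0 a b ha hab (by omega))
      (H.clockwise 0 b m (by omega) hb hm) (H.clockwise a b m hab hb hm)
  clockwise a b c _ hab hbc hc := by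
    rw [orient_sub]
    exact H.clockwise a b c hab hbc (hc.trans_lt H.min_lt)

/-- Reflection in `q` preserves orientation and reverses the lexicographic order, so the increasing
part of the hull becomes a decreasing clockwise chain. The order inside it follows from
`lexPos_sub_of_clockwise` with the lexicographic minimum as first and the maximum as last point. -/
theorem upper (H : IsClockwiseHull S h v m) (q : ℝ × ℝ) :
    ClockwiseChain (fun t => -(v t - q)) m (h - 1) where
  desc a b ha hab hb := by
    have hm := H.min_lt
    show LexPos (-(v a - q) - -(v b - q))
    rcases ha.eq_or_lt with rfl | ha
    · have := H.lexPos_min (t := b) (by omega) (by omega)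
      rwa [show -(v m - q) - -(v b - q) = v b - v m by abel]
    -- If `m = 0`, the maximum and the minimum coincide and there is no second vertex.
    have hm0 : 0 < m := by
      by_contra hc
      obtain rfl : m = 0 := by omega
      have h1 := H.lexPos_min (t := a) (by omega) (by omega)
      have h2 := H.lexPos_first (t := a) (by omega) (by omega)
      rw [← neg_sub] at h2
      exact h1.not_neg h2
    refine lexPos_sub_of_clockwise (o := -(v m - q)) (z := -(v 0 - q)) ?_ ?_ ?_ ?_ ?_
    · rw [show -(v m - q) - -(v b - q) = v b - v m by abel]
      exact H.lexPos_min (by omega) (by omega)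
    · rw [show -(v a - q) - -(v 0 - q) = v 0 - v a by abel]
      exact H.lexPos_first (by omega) (by omega)
    · rw [orient_neg_sub]; exact H.clockwise m a b ha hab (by omega)
    · rw [orient_neg_sub, orient_rotate]; exact H.clockwise 0 m b hm0 (by omega) (by omega)
    · rw [orient_neg_sub, orient_rotate]; exact H.clockwise 0 a b (by omega) hab (by omega)
  clockwise a b c _ hab hbc hc := by
    have hm := H.min_lt
    rw [orient_neg_sub]
    exact H.clockwise a b c hab hbc (by omega)

end IsClockwiseHull

theorem finite_canonicalSubset {n : ℕ} (p : Fin n → ℝ × ℝ) (k b : ℕ) :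
    (canonicalSubset p k b).Finite :=
  (Set.toFinite _).image p

theorem ncard_canonicalSubset_le {n : ℕ} (p : Fin n → ℝ × ℝ) (k b : ℕ) :
    (canonicalSubset p k b).ncard ≤ 2 ^ k := by
  refine (Set.ncard_image_le (Set.toFinite _)).trans ?_
  rw [← Set.ncard_image_of_injective _ Fin.val_injective]
  refine (Set.ncard_le_ncard (t := ↑(Finset.Ico (b * 2 ^ k) ((b + 1) * 2 ^ k))) ?_
    (Finset.finite_toSet _)).trans ?_
  · rintro _ ⟨t, ht, rfl⟩
    simpa using ht
  · rw [Set.ncard_coe_finset, Nat.card_Ico, add_mul, one_mul, Nat.add_sub_cancel_left]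

/-! ### Tangents of a convex set through a point -/

theorem isLinearMap_cross (a : ℝ × ℝ) : IsLinearMap ℝ (cross a) where
  map_add x y := by simp only [cross, Prod.fst_add, Prod.snd_add]; ring
  map_smul c x := by simp only [cross, Prod.smul_fst, Prod.smul_snd, smul_eq_mul]; ring

theorem lineThrough_eq {q u : ℝ × ℝ} (hu : u ≠ 0) :
    lineThrough q (q + u) = {z | cross u (z - q) = 0} := by
  ext z
  have h := vadd_left_mem_affineSpan_pair (k := ℝ) (p₁ := q) (p₂ := q + u)
    (v := z - q)
  rw [vadd_eq_add, sub_add_cancel, vsub_eq_sub, add_sub_cancel_left] at h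
  rw [lineThrough, SetLike.mem_coe, h, Set.mem_ofPred_eq]
  generalize z - q = x
  constructor
  · rintro ⟨r, rfl⟩
    rw [(isLinearMap_cross u).map_smul, cross_self, smul_zero]
  · intro h
    simp only [cross] at h
    by_cases ha : u.1 = 0
    · have hb : u.2 ≠ 0 := fun hb => hu (Prod.ext ha hb)
      rw [ha, zero_mul, zero_sub, neg_eq_zero] at h
      have hx := (mul_eq_zero.1 h).resolve_left hb
      refine ⟨x.2 / u.2, Prod.ext ?_ ?_⟩
      · simp [ha, hx]
      · simp [hb]
    · refine ⟨x.1 / u.1, Prod.ext ?_ ?_⟩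
      · simp [ha]
      · simp only [Prod.smul_snd, smul_eq_mul]
        field_simp
        linarith

theorem isTangent_of_cross_nonneg {K : Set (ℝ × ℝ)} {q u : ℝ × ℝ} (hu : u ≠ 0) (huK : q + u ∈ K)
    (h : ∀ z ∈ K, 0 ≤ cross u (z - q)) : IsTangent K {z | cross u (z - q) = 0} := by
  refine ⟨-u.2, u.1, -u.2 * q.1 + u.1 * q.2, ?_, ?_, ?_, ?_⟩
  · by_contra hc
    push Not at hc
    exact hu (Prod.ext hc.2 (neg_eq_zero.1 hc.1))
  · ext z
    simp only [cross, Set.mem_ofPred_eq, Prod.fst_sub, Prod.snd_sub]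
    constructor <;> intro h <;> linarith
  · intro z hz
    have := h z hz
    simp only [cross, Prod.fst_sub, Prod.snd_sub] at this
    linarith
  · exact ⟨q + u, by simp [cross_self], huK⟩

/-- `q` is outside `K`, and the tangents of `K` through `q` are the lines in the directions `u` and
`v`, which point from `q` to points of `K`. -/
def TangentPair (K : Set (ℝ × ℝ)) (q u v : ℝ × ℝ) : Prop :=
  q ∉ K ∧ q + u ∈ K ∧ q + v ∈ K ∧
    {L | q ∈ L ∧ IsTangent K L} = {lineThrough q (q + u), lineThrough q (q + v)}

/-- A supporting functional through `q` that vanishes at a contact point `z` is nonnegative at `u`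
and `v`, while `z - q` lies in the wedge between them; so it must vanish at `u` or at `v`. The
vector `e` serves only to keep `q` out of `K`. -/
theorem tangentPair_of_cross {K : Set (ℝ × ℝ)} {q u v e : ℝ × ℝ} (hu : q + u ∈ K) (hv : q + v ∈ K)
    (he : ∀ z ∈ K, 0 < cross e (z - q)) (h1 : ∀ z ∈ K, 0 ≤ cross u (z - q))
    (h2 : ∀ z ∈ K, cross v (z - q) ≤ 0) : TangentPair K q u v := by
  have hne : ∀ x, q + x ∈ K → x ≠ 0 := by
    rintro x hx rfl
    have := he _ hx
    simp [cross] at this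
  have hline : ∀ (x : ℝ × ℝ) (a b : ℝ), x ≠ 0 → (a ≠ 0 ∨ b ≠ 0) → a * x.1 + b * x.2 = 0 →
      {z : ℝ × ℝ | a * z.1 + b * z.2 = a * q.1 + b * q.2} = lineThrough q (q + x) := by
    intro x a b hx hab h0
    rw [lineThrough_eq hx]
    ext z
    simp only [Set.mem_ofPred_eq, cross, Prod.fst_sub, Prod.snd_sub]
    constructor
    · intro hz
      have e1 : a * (x.1 * (z.2 - q.2) - x.2 * (z.1 - q.1)) = 0 := by
        linear_combination (z.2 - q.2) * h0 - x.2 * hz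
      have e2 : b * (x.1 * (z.2 - q.2) - x.2 * (z.1 - q.1)) = 0 := by
        linear_combination x.1 * hz - (z.1 - q.1) * h0
      rcases hab with ha | hb
      · exact (mul_eq_zero.1 e1).resolve_left ha
      · exact (mul_eq_zero.1 e2).resolve_left hb
    · intro hz
      have e1 : x.1 * (a * (z.1 - q.1) + b * (z.2 - q.2)) = 0 := by
        linear_combination (z.1 - q.1) * h0 + b * hz
      have e2 : x.2 * (a * (z.1 - q.1) + b * (z.2 - q.2)) = 0 := by
        linear_combination (z.2 - q.2) * h0 - a * hz
      have : a * (z.1 - q.1) + b * (z.2 - q.2) = 0 := by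
        by_contra hc
        exact hx (Prod.ext ((mul_eq_zero.1 e1).resolve_right hc)
          ((mul_eq_zero.1 e2).resolve_right hc))
      linarith
  refine ⟨fun hq => hne 0 (by simpa using hq) rfl, hu, hv, ?_⟩
  ext L
  simp only [Set.mem_ofPred_eq, Set.mem_insert_iff, Set.mem_singleton_iff]
  constructor
  · rintro ⟨hqL, a, b, c, hab, rfl, hK, z, hzL, hzK⟩
    simp only [Set.mem_ofPred_eq] at hqL hzL
    subst hqL
    have gu := hK _ hu
    have gv := hK _ hv
    simp only [Prod.fst_add, Prod.snd_add] at gu gv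
    have i1 := h1 z hzK
    have i2 := h2 z hzK
    have hz := hne (z - q) (by simpa using hzK)
    -- The identity `(u × v) f x = -(v × x) f u + (u × x) f v` at `x = z - q`, where `f x = 0`. Both
    -- summands on the right are nonnegative, so each is zero.
    have key : -cross v (z - q) * (a * u.1 + b * u.2)
        + cross u (z - q) * (a * v.1 + b * v.2) = 0 := by
      simp only [cross, Prod.fst_sub, Prod.snd_sub]
      linear_combination (u.1 * v.2 - u.2 * v.1) * hzL
    have k1 : 0 ≤ -cross v (z - q) * (a * u.1 + b * u.2) :=
      mul_nonneg (by linarith) (by linarith)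
    have k2 : 0 ≤ cross u (z - q) * (a * v.1 + b * v.2) := mul_nonneg i1 (by linarith)
    by_cases c1 : a * u.1 + b * u.2 = 0
    · exact .inl (hline u a b (hne u hu) hab c1)
    by_cases c2 : a * v.1 + b * v.2 = 0
    · exact .inr (hline v a b (hne v hv) hab c2)
    have k3 : cross u (z - q) = 0 :=
      (mul_eq_zero.1 (show cross u (z - q) * (a * v.1 + b * v.2) = 0 by linarith)).resolve_right c2
    simp only [cross, Prod.fst_sub, Prod.snd_sub] at k3
    exfalso
    have e1 : (z - q).1 * (a * u.1 + b * u.2) = 0 := by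
      simp only [Prod.fst_sub]
      linear_combination u.1 * hzL - b * k3
    have e2 : (z - q).2 * (a * u.1 + b * u.2) = 0 := by
      simp only [Prod.snd_sub]
      linear_combination u.2 * hzL + a * k3
    exact hz (Prod.ext ((mul_eq_zero.1 e1).resolve_right c1) ((mul_eq_zero.1 e2).resolve_right c1))
  · rintro (rfl | rfl)
    · rw [lineThrough_eq (hne u hu)]
      exact ⟨by simp [cross], isTangent_of_cross_nonneg (hne u hu) hu h1⟩
    · rw [lineThrough_eq (hne v hv)]
      refine ⟨by simp [cross], ?_⟩
      refine ⟨v.2, -v.1, v.2 * q.1 - v.1 * q.2, ?_, ?_, ?_, ?_⟩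
      · by_contra hc
        push Not at hc
        exact hne v hv (Prod.ext (neg_eq_zero.1 hc.2) hc.1)
      · ext z
        simp only [cross, Set.mem_ofPred_eq, Prod.fst_sub, Prod.snd_sub]
        constructor <;> intro h <;> linarith
      · intro z hz
        have := h2 z hz
        simp only [cross, Prod.fst_sub, Prod.snd_sub] at this
        linarith
      · exact ⟨q + v, by simp [cross_self], hv⟩

/-! ### From extreme directions to tangents -/

/-- Normalizing the weights to sum to one lets them serve directly as convex coefficients once one
vector is replaced by its opposite. -/
theorem exists_weights {a b x : ℝ × ℝ} (ha : LexPos a) (hb : LexPos b) (hx : LexPos x)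
    (h1 : 0 ≤ cross a x) (h2 : cross b x ≤ 0) :
    ∃ l m n : ℝ, 0 ≤ l ∧ 0 ≤ m ∧ 0 ≤ n ∧ l + m + n = 1 ∧ l • a + m • b = n • x := by
  suffices ∃ l m n : ℝ, 0 ≤ l ∧ 0 ≤ m ∧ 0 < n ∧ l • a + m • b = n • x by
    obtain ⟨l, m, n, hl, hm, hn, h⟩ := this
    have hs : 0 < l + m + n := by linarith
    refine ⟨l / (l + m + n), m / (l + m + n), n / (l + m + n), by positivity, by positivity,
      by positivity, by field_simp, ?_⟩
    have := congrArg (fun y => (l + m + n)⁻¹ • y) h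
    simp only [smul_add, smul_smul] at this
    simpa only [div_eq_inv_mul] using this
  have h3 : 0 ≤ cross x b := by rw [cross_swap]; linarith
  rcases (cross_nonneg_trans ha hx hb h1 h3).lt_or_eq with h | h
  -- Cramer's rule.
  · refine ⟨cross x b, cross a x, cross a b, h3, h1, h, ?_⟩
    ext <;> simp [cross] <;> ring
  -- Here all three directions agree and Cramer's rule degenerates. The values of a positive
  -- functional give the ratio of `x` to `a`.
  · obtain ⟨ε, e1, e2, e3⟩ := (ha.eventually.and (hb.eventually.and hx.eventually)).exists
    have key : (a.1 + ε * a.2) * cross x b + (b.1 + ε * b.2) * cross a x = 0 := by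
      have : (a.1 + ε * a.2) * cross x b + (b.1 + ε * b.2) * cross a x
          = (x.1 + ε * x.2) * cross a b := by simp only [cross]; ring
      rw [this, ← h, mul_zero]
    have h4 : cross a x = 0 := by
      have i1 := mul_nonneg e1.le h3
      have i2 := mul_nonneg e2.le h1
      exact (mul_eq_zero.1 (show (b.1 + ε * b.2) * cross a x = 0 by linarith)).resolve_left e2.ne'
    refine ⟨x.1 + ε * x.2, 0, a.1 + ε * a.2, e3.le, le_rfl, e1, ?_⟩
    simp only [cross] at h4
    ext
    · simp only [zero_smul, add_zero, Prod.smul_fst, smul_eq_mul]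
      linear_combination ε * h4
    · simp only [zero_smul, add_zero, Prod.smul_snd, smul_eq_mul]
      linear_combination -h4

theorem mem_of_balanced {K : Set (ℝ × ℝ)} (hK : Convex ℝ K) {q a b x : ℝ × ℝ} (ha : q + a ∈ K)
    (hb : q + b ∈ K) (hx : q + x ∈ K) {l m n : ℝ} (hl : 0 ≤ l) (hm : 0 ≤ m) (hn : 0 ≤ n)
    (h1 : l + m + n = 1) (h : l • a + m • b + n • x = 0) : q ∈ K := by
  have := hK.sum_mem (t := Finset.univ) (w := ![l, m, n]) (z := ![q + a, q + b, q + x])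
    (by intro i _; fin_cases i <;> simpa) (by simpa [Fin.sum_univ_three] using h1)
    (by intro i _; fin_cases i <;> simpa)
  simp only [Fin.sum_univ_three, Matrix.cons_val_zero, Matrix.cons_val_one, Matrix.cons_val] at this
  convert this using 1
  calc q = (1 : ℝ) • q + 0 := by simp
    _ = (l + m + n) • q + (l • a + m • b + n • x) := by rw [h1, h]
    _ = _ := by module

/-- The wedge that leaves `a` last and reaches `d` first when the two ranges of directions are
disjoint. -/
theorem cross_of_disjoint {F : Set (ℝ × ℝ)} {a b c d x : ℝ × ℝ} (hp : Extremes F a b)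
    (hn : Extremes (-F) (-c) (-d)) (h : cross d a < 0) (hx : Spans F x) :
    0 ≤ cross a x ∧ cross d x ≤ 0 ∧ 0 < cross (a - d) x := by
  have ha : LexPos a := by
    rcases hp with ⟨rfl, -, -⟩ | h'
    · simp [cross] at h
    · exact h'.2.2.1
  have hd : LexPos (-d) := by
    rcases hn with ⟨-, h', -⟩ | h'
    · rw [neg_eq_zero] at h'; subst h'; simp [cross] at h
    · exact h'.2.2.2.1
  have hda : 0 ≤ cross (-d) a := by rw [cross_neg_left]; linarith
  have hx0 : x ≠ 0 := by
    rintro rfl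
    obtain ⟨_, -, _, -, h', -⟩ := hx
    rcases h' with h' | h'
    · exact not_lexPos_zero h'.2.2
    · exact not_lexPos_zero (by simpa using h'.2.2)
  have hax : 0 ≤ cross a x ∧ cross d x ≤ 0 := by
    have hx' := hx
    obtain ⟨_, -, _, -, h', -⟩ := hx'
    rcases h' with ⟨-, -, hxp⟩ | ⟨-, -, hxn⟩
    · have h1 := (hp.cross_of_spans hx hxp).2.2.1
      have := cross_nonneg_trans hd ha hxp hda h1
      rw [cross_neg_left] at this
      exact ⟨h1, by linarith⟩
    · obtain ⟨-, -, -, h1⟩ := hn.cross_of_spans hx.neg hxn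
      have := cross_nonneg_trans hxn hd ha (by rw [cross_swap]; linarith) hda
      rw [cross_neg_neg] at h1
      rw [cross_neg_left, cross_swap, neg_neg] at this
      exact ⟨this, h1⟩
  refine ⟨hax.1, hax.2, ?_⟩
  have e : cross (a - d) x = cross a x - cross d x := by
    simp only [cross, Prod.fst_sub, Prod.snd_sub]; ring
  rw [e]
  by_contra hc
  have h1 : cross a x = 0 := by linarith [hax.1, hax.2]
  have h2 : cross d x = 0 := by linarith [hax.1, hax.2]
  -- Since `d` and `a` are independent, a vector parallel to both is zero.
  have e1 : x.1 * cross d a = 0 := by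
    simp only [cross] at h1 h2 ⊢
    linear_combination a.1 * h2 - d.1 * h1
  have e2 : x.2 * cross d a = 0 := by
    simp only [cross] at h1 h2 ⊢
    linear_combination a.2 * h2 - d.2 * h1
  exact hx0 (Prod.ext ((mul_eq_zero.1 e1).resolve_right h.ne)
    ((mul_eq_zero.1 e2).resolve_right h.ne))

/-- The spanned vectors may be infinitely many, so no `ε` can be chosen for all of them directly.
One that works for the two extremes `a` and `b` works for everything between them. -/
theorem exists_separating {F : Set (ℝ × ℝ)} {a b : ℝ × ℝ} (hp : Extremes F a b)
    (hF : ∀ x ∈ F, ¬ LexPos (-x)) :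
    ∃ e, ∀ x, Spans F x → 0 ≤ cross a x ∧ cross b x ≤ 0 ∧ 0 < cross e x := by
  have hpos : ∀ x, Spans F x → LexPos x := by
    rintro x ⟨c, hc, _, -, h', -⟩
    exact (h'.resolve_right fun h => hF c hc h.1).2.2
  by_cases hx : ∃ x, Spans F x
  · obtain ⟨x₀, hx₀⟩ := hx
    obtain ⟨ha, hb, -⟩ := hp.cross_of_spans hx₀ (hpos x₀ hx₀)
    obtain ⟨ε, e1, e2⟩ := (ha.eventually.and hb.eventually).exists
    -- `cross (ε, -1) x` is the functional `x.1 + ε * x.2`.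
    refine ⟨(ε, -1), fun x hx => ?_⟩
    obtain ⟨-, -, h1, h2⟩ := hp.cross_of_spans hx (hpos x hx)
    refine ⟨h1, h2, ?_⟩
    obtain ⟨l, m, n, hl, hm, hn, hs, h⟩ := exists_weights ha hb (hpos x hx) h1 h2
    have key : n * cross (ε, -1) x = l * (a.1 + ε * a.2) + m * (b.1 + ε * b.2) := by
      have := congrArg (cross (ε, -1)) h
      simp only [(isLinearMap_cross _).map_add, (isLinearMap_cross _).map_smul, smul_eq_mul] at this
      rw [← this]
      simp only [cross]; ring
    have hlm : 0 < l + m := by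
      by_contra hc
      obtain rfl : l = 0 := by linarith
      obtain rfl : m = 0 := by linarith
      obtain rfl : n = 1 := by linarith
      simp only [zero_smul, add_zero, one_smul] at h
      exact (hpos x hx).ne_zero h.symm
    refine pos_of_mul_pos_right (a := n) ?_ hn
    rw [key]
    rcases hl.lt_or_eq with hl | rfl
    · have := mul_pos hl e1
      have := mul_nonneg hm e2.le
      linarith
    · have := mul_pos (show 0 < m by linarith) e2
      linarith
  · exact ⟨0, fun x h => (hx ⟨x, h⟩).elim⟩

/-- The decision from the extreme directions `a, b` on the positive and `c, d` on the negative
side. -/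
theorem tangents_of_extremes {K F : Set (ℝ × ℝ)} {q a b c d : ℝ × ℝ} (hK : Convex ℝ K)
    (hne : K.Nonempty) (hFK : ∀ x ∈ F, q + x ∈ K)
    (hKF : ∀ z ∈ K, z - q ∈ convexHull ℝ {x | Spans F x})
    (hp : Extremes F a b) (hn : Extremes (-F) (-c) (-d)) :
    (cross d a < 0 → TangentPair K q a d) ∧ (0 < cross c b → TangentPair K q c b) ∧
    (¬ cross d a < 0 → ¬ 0 < cross c b → (a = 0 → TangentPair K q c d) ∧
      (a ≠ 0 → c = 0 → TangentPair K q a b) ∧ (a ≠ 0 → c ≠ 0 → q ∈ K)) := by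
  have pair : ∀ u v e : ℝ × ℝ, q + u ∈ K → q + v ∈ K →
      (∀ x, Spans F x → 0 ≤ cross u x ∧ cross v x ≤ 0 ∧ 0 < cross e x) → TangentPair K q u v := by
    intro u v e hu hv h
    have : ∀ z ∈ K, 0 ≤ cross u (z - q) ∧ cross v (z - q) ≤ 0 ∧ 0 < cross e (z - q) := by
      intro z hz
      have h' := convexHull_min (s := {x | Spans F x}) (t := {x | 0 ≤ cross u x} ∩
        ({x | cross v x ≤ 0} ∩ {x | 0 < cross e x})) h
        ((convex_halfSpace_ge (isLinearMap_cross u) 0).inter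
          ((convex_halfSpace_le (isLinearMap_cross v) 0).inter
            (convex_halfSpace_gt (isLinearMap_cross e) 0))) (hKF z hz)
      exact h'
    exact tangentPair_of_cross hu hv (fun z hz => (this z hz).2.2) (fun z hz => (this z hz).1)
      (fun z hz => (this z hz).2.1)
  have hspan : ∃ x, Spans F x := by
    obtain ⟨z, hz⟩ := hne
    have : (convexHull ℝ {x | Spans F x}).Nonempty := ⟨_, hKF z hz⟩
    exact convexHull_nonempty_iff.1 this
  have hP : a ≠ 0 → a ∈ F ∧ b ∈ F ∧ LexPos a ∧ LexPos b := by
    intro h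
    rcases hp with h' | h'
    · exact (h h'.1).elim
    · exact ⟨h'.1, h'.2.1, h'.2.2.1, h'.2.2.2.1⟩
  have hN : c ≠ 0 → c ∈ F ∧ d ∈ F ∧ LexPos (-c) ∧ LexPos (-d) := by
    intro h
    rcases hn with h' | h'
    · exact (h (by simpa using h'.1)).elim
    · exact ⟨by simpa using h'.1, by simpa using h'.2.1, h'.2.2.1, h'.2.2.2.1⟩
  have ha0 : a = 0 → b = 0 ∧ ∀ x ∈ F, ¬ LexPos x := by
    rintro rfl
    rcases hp with h' | h'
    · exact h'.2
    · exact (not_lexPos_zero h'.2.2.1).elim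
  have hc0 : c = 0 → d = 0 ∧ ∀ x ∈ F, ¬ LexPos (-x) := by
    rintro rfl
    rcases hn with h' | h'
    · exact ⟨by simpa using h'.2.1, fun x hx => h'.2.2 _ (by simpa using hx)⟩
    · exact (not_lexPos_zero (by simpa using h'.2.2.1)).elim
  have hboth : ¬ (a = 0 ∧ c = 0) := by
    rintro ⟨h1, h2⟩
    obtain ⟨x, y, hy, _, -, h', -⟩ := hspan
    rcases h' with h' | h'
    · exact (ha0 h1).2 y hy h'.1
    · exact (hc0 h2).2 y hy h'.1
  refine ⟨fun h => ?_, fun h => ?_, fun h1 h2 => ⟨fun h => ?_, fun h h' => ?_, fun h h' => ?_⟩⟩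
  · have h1 : a ≠ 0 := by rintro rfl; simp [cross] at h
    have h2 : c ≠ 0 := by intro hc; rw [(hc0 hc).1] at h; simp [cross] at h
    exact pair a d (a - d) (hFK _ (hP h1).1) (hFK _ (hN h2).2.1)
      fun x hx => cross_of_disjoint hp hn h hx
  · have h1 : a ≠ 0 := by intro ha; rw [(ha0 ha).1] at h; simp [cross] at h
    have h2 : c ≠ 0 := by rintro rfl; simp [cross] at h
    refine pair c b (c - b) (hFK _ (hN h2).1) (hFK _ (hP h1).2.1) fun x hx => ?_
    -- The mirror image of the first case: reflection in the origin exchanges the two sides.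
    have := cross_of_disjoint (c := -a) (d := -b) hn (by simpa using hp)
      (by rw [cross_neg_neg, cross_swap]; linarith) hx.neg
    rw [← neg_sub', cross_neg_neg, cross_neg_neg, cross_neg_neg] at this
    exact this
  · have hc : c ≠ 0 := fun hc => hboth ⟨h, hc⟩
    obtain ⟨e, he⟩ := exists_separating hn
      (fun x hx hx' => (ha0 h).2 (-x) (by simpa using hx) hx')
    refine pair c d (-e) (hFK _ (hN hc).1) (hFK _ (hN hc).2.1) fun x hx => ?_
    have := he (-x) hx.neg
    rw [cross_neg_neg, cross_neg_neg, cross_neg_right, ← cross_neg_left] at this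
    exact this
  · obtain ⟨e, he⟩ := exists_separating hp (hc0 h').2
    exact pair a b e (hFK _ (hP h).1) (hFK _ (hP h).2.1) he
  · obtain ⟨fa, fb, pa, pb⟩ := hP h
    obtain ⟨fc, fd, pc, pd⟩ := hN h'
    -- Two ranges `[a, b]` and `[-c, -d]` that meet contain the least direction of one in the other.
    -- Either `a` lies between `-c` and `-d`, or `-c` lies between `a` and `b`; in both cases three
    -- fed vectors balance to zero.
    by_cases hac : cross c a ≤ 0
    · obtain ⟨l, m, n, hl, hm, hn, hs, e⟩ := exists_weights pc pd pa
        (by rw [cross_neg_left]; linarith) (by rw [cross_neg_left]; linarith)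
      refine mem_of_balanced hK (hFK _ fc) (hFK _ fd) (hFK _ fa) hl hm hn hs ?_
      rw [← e]; module
    · obtain ⟨l, m, n, hl, hm, hn, hs, e⟩ := exists_weights pa pb pc
        (by rw [cross_neg_right, cross_swap]; linarith)
        (by rw [cross_neg_right, cross_swap]; linarith)
      refine mem_of_balanced hK (hFK _ fa) (hFK _ fb) (hFK _ fc) hl hm hn hs ?_
      rw [e]; module

/-! ### Total correctness with a time bound -/

/-- Started with registers `s`, the program halts within `T` steps with registers satisfying `Q`. -/
def Wp (mem : Memory) (c : Program) (s : Regs) (T : ℕ) (Q : Regs → Prop) : Prop :=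
  ∃ t s', Exec mem c s t s' ∧ t ≤ T ∧ Q s'

namespace Wp

variable {mem : Memory} {c d : Program} {e : Test} {s : Regs} {T T' : ℕ} {Q R : Regs → Prop}

theorem mono (h : Wp mem c s T Q) (hT : T ≤ T') (hQ : ∀ s', Q s' → R s') : Wp mem c s T' R := by
  obtain ⟨t, s', h1, h2, h3⟩ := h
  exact ⟨t, s', h1, h2.trans hT, hQ s' h3⟩

theorem weaken (hT : T ≤ T') (h : Wp mem c s T Q) : Wp mem c s T' Q := h.mono hT fun _ => id

theorem seq (h : Wp mem c s T R) (h' : ∀ s', R s' → Wp mem d s' T' Q) :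
    Wp mem (.seq c d) s (T + T') Q := by
  obtain ⟨t, s', h1, h2, h3⟩ := h
  obtain ⟨t', s'', h4, h5, h6⟩ := h' s' h3
  exact ⟨_, _, .seq h1 h4, Nat.add_le_add h2 h5, h6⟩

theorem instr {i : Instr} (h : Q (i.apply mem s)) : Wp mem (.instr i) s 1 Q :=
  ⟨_, _, .instr i s, le_rfl, h⟩

theorem ite (h : e.Holds s → Wp mem c s T Q) (h' : ¬ e.Holds s → Wp mem d s T Q) :
    Wp mem (.ite e c d) s (T + 1) Q := by
  by_cases he : e.Holds s
  · obtain ⟨t, s', h1, h2, h3⟩ := h he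
    exact ⟨_, _, .iteTrue he h1, by omega, h3⟩
  · obtain ⟨t, s', h1, h2, h3⟩ := h' he
    exact ⟨_, _, .iteFalse he h1, by omega, h3⟩

/-- The loop rule: `I N` is the invariant when at most `N` iterations remain. -/
theorem loop {I : ℕ → Regs → Prop}
    (h : ∀ N s, I N s → e.Holds s → ∃ N', N = N' + 1 ∧ Wp mem c s T (I N')) (N : ℕ) :
    ∀ s, I N s → Wp mem (.loop e c) s (N * (T + 1) + 1) fun s' => (∃ N', I N' s') ∧ ¬ e.Holds s' := by
  induction N with
  | zero =>
    intro s hs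
    refine ⟨1, s, .loopDone fun he => ?_, by omega, ⟨0, hs⟩, fun he => ?_⟩ <;>
    · obtain ⟨N', hN, -⟩ := h 0 s hs he
      omega
  | succ N ih =>
    intro s hs
    by_cases he : e.Holds s
    · obtain ⟨N', hN, t, s', h1, h2, h3⟩ := h _ s hs he
      obtain rfl : N' = N := by omega
      obtain ⟨t', s'', h4, h5, h6⟩ := ih s' h3
      refine ⟨_, s'', .loopStep he h1 h4, ?_, h6⟩
      rw [add_mul]
      omega
    · exact ⟨1, s, .loopDone he, by omega, ⟨_, hs⟩, he⟩

end Wp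

/-- The instruction list as a program, with one idle step at its end. -/
def instrs : List Instr → Program
  | [] => .instr (.natCopy 0 0)
  | i :: l => .seq (.instr i) (instrs l)

/-- The effect of an instruction list. -/
noncomputable def applyAll (mem : Memory) : List Instr → Regs → Regs
  | [], s => s
  | i :: l, s => applyAll mem l (i.apply mem s)

theorem Wp.instrs {mem : Memory} {l : List Instr} {s : Regs} {Q : Regs → Prop}
    (h : Q (applyAll mem l s)) : Wp mem (instrs l) s (l.length + 1) Q := by
  induction l generalizing s with
  | nil =>
    refine Wp.instr ?_
    simpa [Instr.apply, applyAll] using h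
  | cons i l ih =>
    refine Wp.weaken (T := 1 + (l.length + 1)) (by simp; omega) ?_
    exact Wp.seq (R := fun s' => s' = i.apply mem s) (Wp.instr rfl) fun s' hs' => by
      subst hs'; exact ih h

/-! ### Program fragments

Natural number registers: `0` the leaves, `1`, `2` the remaining blocks of the current level, `3`, `4`
their outermost nodes, `5` whether `q` itself was met, `6` the current node, `7` its hull, `8`, `9` the
current chain, `10`, `11`, `12` the binary search, `13`, `14` data of the node, from `20` on scratch.
Real registers: `0`, `1` the query point, `2, …, 9` the extreme directions, `10` the sign of the
current chain, from `11` on scratch. -/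

/-- Two adjacent real registers as a vector. -/
def Regs.pair (s : Regs) (a : ℕ) : ℝ × ℝ := (s.real a, s.real (a + 1))

/-- The vector from the query point to the `t`-th point of the current hull. -/
noncomputable def Regs.vec (mem : Memory) (s : Regs) (t : ℕ) : ℝ × ℝ :=
  mem.point (s.nat 7) t - s.pair 0

/-- Load the vector with its index in register `x` into the real registers `d`, `d + 1`. -/
def loadVec (x d : ℕ) : Program := instrs
  [.natAdd 20 x x, .natAdd 20 7 20, .realLoad d 20, .natConst 21 1, .natAdd 20 20 21,
    .realLoad (d + 1) 20, .realSub d d 0, .realSub (d + 1) (d + 1) 1]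

theorem wp_loadVec (mem : Memory) (s : Regs) (x d : ℕ) (hd : 11 ≤ d) :
    Wp mem (loadVec x d) s 9 fun s' => s'.pair d = s.vec mem (s.nat x) ∧
      (∀ r, r ≠ 20 → r ≠ 21 → s'.nat r = s.nat r) ∧
      ∀ r, r ≠ d → r ≠ d + 1 → s'.real r = s.real r := by
  refine Wp.instrs ⟨?_, ?_, ?_⟩
  · have h1 : d ≠ 0 := by omega
    have h2 : d ≠ 1 := by omega
    have h3 : 1 ≠ d := by omega
    have h4 : 0 ≠ d := by omega
    ext <;> simp [applyAll, Instr.apply, Regs.pair, Regs.vec, Memory.point, 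
      two_mul, h1, h3, h4, add_assoc]
  · intro r h1 h2
    simp [applyAll, Instr.apply, Function.update_apply, h1, h2]
  · intro r h1 h2
    simp [applyAll, Instr.apply, Function.update_apply, h1, h2]

/-- Branch on whether the vector in the real registers `x`, `x + 1` is lexicographically positive. -/
def ifLexPos (x : ℕ) (c d : Program) : Program :=
  .seq (.instr (.realConst 11 0))
    (.ite (.realLt 11 x) c (.ite (.realLt x 11) d (.ite (.realLt 11 (x + 1)) c d)))

theorem wp_ifLexPos {mem : Memory} {s : Regs} {x : ℕ} {c d : Program} {T : ℕ} {Q : Regs → Prop}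
    (hx : 11 < x)
    (hc : LexPos (s.pair x) → Wp mem c ((Instr.realConst 11 0).apply mem s) T Q)
    (hd : ¬ LexPos (s.pair x) → Wp mem d ((Instr.realConst 11 0).apply mem s) T Q) :
    Wp mem (ifLexPos x c d) s (T + 4) Q := by
  have h1 : x ≠ 11 := by omega
  have h2 : x + 1 ≠ 11 := by omega
  refine Wp.weaken (T := 1 + (T + 1 + 1 + 1)) (by omega) ?_
  refine Wp.seq (R := fun s' => s' = (Instr.realConst 11 0).apply mem s) (Wp.instr rfl) ?_
  rintro _ rfl
  refine Wp.ite (fun e1 => ?_) (fun e1 => Wp.ite (fun e2 => ?_) (fun e2 => Wp.ite (fun e3 => ?_)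
    (fun e3 => ?_)))
  · refine Wp.weaken (by omega) (hc (.inl ?_))
    simpa [Test.Holds, Instr.apply, h1, Regs.pair] using e1
  · refine Wp.weaken (by omega) (hd ?_)
    simp only [Test.Holds, Instr.apply, Function.update_self, Function.update_of_ne h1, Int.cast_zero,
      not_lt] at e1 e2
    rintro (h | ⟨h, -⟩)
    · exact absurd h (not_lt.2 e1)
    · exact e2.ne h
  · simp only [Test.Holds, Instr.apply, Function.update_self, Function.update_of_ne h1,
      Function.update_of_ne h2, Int.cast_zero, not_lt] at e1 e2 e3
    exact hc (.inr ⟨le_antisymm e1 e2, e3⟩)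
  · simp only [Test.Holds, Instr.apply, Function.update_self, Function.update_of_ne h1,
      Function.update_of_ne h2, Int.cast_zero, not_lt] at e1 e2 e3
    refine hd ?_
    rintro (h | ⟨-, h⟩)
    · exact absurd h (not_lt.2 e1)
    · exact absurd h (not_lt.2 e3)

/-- Compare the vector in `12`, `13` with the extreme directions in `a, …, a + 3`. -/
def update (a : ℕ) : Program :=
  .seq (instrs [.realMul 16 a 13, .realMul 17 (a + 1) 12])
    (.seq (.ite (.realLe 16 17) (instrs [.realCopy a 12, .realCopy (a + 1) 13]) (instrs []))
      (.seq (instrs [.realMul 16 (a + 2) 13, .realMul 17 (a + 3) 12])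
        (.ite (.realLe 17 16) (instrs [.realCopy (a + 2) 12, .realCopy (a + 3) 13]) (instrs []))))

open Classical in
theorem wp_update (mem : Memory) (s : Regs) (a : ℕ) (ha : a + 4 ≤ 11) :
    Wp mem (update a) s 20 fun s' =>
      s'.pair a = (if cross (s.pair a) (s.pair 12) ≤ 0 then s.pair 12 else s.pair a) ∧
      s'.pair (a + 2) = (if 0 ≤ cross (s.pair (a + 2)) (s.pair 12) then s.pair 12
        else s.pair (a + 2)) ∧
      s'.nat = s.nat ∧ ∀ r, (r < a ∨ a + 4 ≤ r) → r ≠ 16 → r ≠ 17 → s'.real r = s.real r := by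
  have n1 : a ≠ 16 := by omega
  have n2 : a ≠ 17 := by omega
  have n3 : a ≠ 15 := by omega
  have n5 : a ≠ 13 := by omega
  have m5 := n5.symm
  have hr : ∀ r, (r < a ∨ a + 4 ≤ r) → r ≠ a ∧ r ≠ a + 1 ∧ r ≠ a + 2 ∧ r ≠ a + 3 := by omega
  refine Wp.weaken (T := 3 + ((3 + 1) + (3 + (3 + 1)))) (by omega) ?_
  refine Wp.seq (R := fun s' => s'.real 16 = s.real a * s.real 13 ∧
    s'.real 17 = s.real (a + 1) * s.real 12 ∧ s'.nat = s.nat ∧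
    ∀ r, r ≠ 16 → r ≠ 17 → s'.real r = s.real r) (Wp.instrs ?_) ?_
  · refine ⟨?_, ?_, ?_, ?_⟩ <;>
      simp +contextual [applyAll, Instr.apply, n3]
  rintro s1 ⟨h1, h2, h3, h4⟩
  refine Wp.seq (R := fun s' =>
      s'.pair a = (if cross (s.pair a) (s.pair 12) ≤ 0 then s.pair 12 else s.pair a) ∧
      s'.nat = s.nat ∧ ∀ r, r ≠ a → r ≠ a + 1 → r ≠ 16 → r ≠ 17 → s'.real r = s.real r)
    (Wp.ite (fun e => Wp.instrs ?_)
      (fun e => Wp.weaken (T := 1) (by omega) (Wp.instrs ?_))) ?_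
  · simp only [Test.Holds, h1, h2] at e
    have e' : cross (s.pair a) (s.pair 12) ≤ 0 := by simp only [cross, Regs.pair]; linarith
    rw [if_pos e']
    refine ⟨?_, ?_, ?_⟩
    · ext <;> simp [applyAll, Instr.apply, Regs.pair, h4, m5]
    · simp [applyAll, Instr.apply, h3]
    · intro r r1 r2 r3 r4
      simp [applyAll, Instr.apply, Function.update_apply, r1, r2, h4 r r3 r4]
  · simp only [Test.Holds, h1, h2] at e
    have e' : ¬ cross (s.pair a) (s.pair 12) ≤ 0 := by
      simp only [cross, Regs.pair]; intro h; exact e (by linarith)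
    rw [if_neg e']
    refine ⟨?_, ?_, ?_⟩
    · ext <;> simp [applyAll, Regs.pair, h4, n1, n2, n3]
    · simp [applyAll, h3]
    · intro r r1 r2 r3 r4
      simp [applyAll, h4 r r3 r4]
  rintro s2 ⟨g1, g2, g3⟩
  have g4 : s2.real 12 = s.real 12 := g3 _ (by omega) (by omega) (by omega) (by omega)
  have g5 : s2.real 13 = s.real 13 := g3 _ (by omega) (by omega) (by omega) (by omega)
  have g6 : s2.real (a + 2) = s.real (a + 2) := g3 _ (by omega) (by omega) (by omega) (by omega)
  have g7 : s2.real (a + 3) = s.real (a + 3) := g3 _ (by omega) (by omega) (by omega) (by omega)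
  refine Wp.seq (R := fun s' => s'.real 16 = s.real (a + 2) * s.real 13 ∧
    s'.real 17 = s.real (a + 3) * s.real 12 ∧ s'.nat = s.nat ∧
    ∀ r, r ≠ 16 → r ≠ 17 → s'.real r = s2.real r) (Wp.instrs ?_) ?_
  · refine ⟨?_, ?_, ?_, ?_⟩ <;>
      simp +contextual [applyAll, Instr.apply, n5, g2, g4, g5, g6, g7]
  rintro s3 ⟨f1, f2, f3, f4⟩
  refine Wp.ite (fun e => Wp.instrs ?_) (fun e => Wp.weaken (T := 1) (by omega) (Wp.instrs ?_))
  · simp only [Test.Holds, f1, f2] at e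
    have e' : 0 ≤ cross (s.pair (a + 2)) (s.pair 12) := by
      simp only [cross, Regs.pair, add_assoc, Nat.reduceAdd]; linarith
    rw [if_pos e', ← g1]
    refine ⟨?_, ?_, ?_, ?_⟩
    · ext <;> simp [applyAll, Instr.apply, Function.update_apply, Regs.pair, f4, n1, n2, n3]
    · ext <;> simp [applyAll, Instr.apply, Function.update_apply, Regs.pair, f4, g4, g5]
      omega
    · simp [applyAll, Instr.apply, f3]
    · intro r r1 r2 r3
      obtain ⟨k1, k2, k3, k4⟩ := hr r r1
      simp [applyAll, Instr.apply, Function.update_apply, k3, k4, f4 r r2 r3, g3 r k1 k2 r2 r3]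
  · simp only [Test.Holds, f1, f2] at e
    have e' : ¬ 0 ≤ cross (s.pair (a + 2)) (s.pair 12) := by
      simp only [cross, Regs.pair, add_assoc, Nat.reduceAdd]; intro h; exact e (by linarith)
    rw [if_neg e', ← g1]
    refine ⟨?_, ?_, ?_, ?_⟩
    · ext <;> simp [applyAll, Regs.pair, f4, n1, n2, n3]
    · refine Prod.ext ?_ ?_
      · exact (f4 (a + 2) (by omega) (by omega)).trans g6
      · exact (f4 (a + 3) (by omega) (by omega)).trans g7
    · simp [applyAll, f3]
    · intro r r1 r2 r3
      obtain ⟨k1, k2, k3, k4⟩ := hr r r1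
      simp [applyAll, f4 r r2 r3, g3 r k1 k2 r2 r3]

/-- The registers hold the extreme directions of the vectors `F`. -/
structure Tracks (F : Set (ℝ × ℝ)) (s : Regs) : Prop where
  flag : s.nat 5 = 0 ↔ 0 ∉ F
  pos : Extremes F (s.pair 2) (s.pair 4)
  neg : Extremes (-F) (-s.pair 6) (-s.pair 8)

theorem Tracks.congr {F : Set (ℝ × ℝ)} {s s' : Regs} (h : Tracks F s) (h5 : s'.nat 5 = s.nat 5)
    (hr : ∀ r, 2 ≤ r → r < 10 → s'.real r = s.real r) : Tracks F s' := by
  have hp : ∀ r, 2 ≤ r → r < 9 → s'.pair r = s.pair r := by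
    intro r h1 h2
    simp [Regs.pair, hr r h1 (by omega), hr (r + 1) (by omega) (by omega)]
  refine ⟨by rw [h5]; exact h.flag, ?_, ?_⟩
  · rw [hp 2 (by omega) (by omega), hp 4 (by omega) (by omega)]; exact h.pos
  · rw [hp 6 (by omega) (by omega), hp 8 (by omega) (by omega)]; exact h.neg

/-- Take the vector with its index in register `x` into account. -/
def feed (x : ℕ) : Program :=
  .seq (loadVec x 12)
    (ifLexPos 12 (update 2)
      (.seq (instrs [.realSub 14 11 12, .realSub 15 11 13])
        (ifLexPos 14 (update 6) (instrs [.natConst 5 1]))))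

theorem wp_feed (mem : Memory) (s : Regs) (x : ℕ) {F : Set (ℝ × ℝ)} (hF : Tracks F s) :
    Wp mem (feed x) s 40 fun s' => Tracks (insert (s.vec mem (s.nat x)) F) s' ∧
      (∀ r, r ≠ 5 → r < 20 → s'.nat r = s.nat r) ∧
      ∀ r, (r < 2 ∨ r = 10) → s'.real r = s.real r := by
  refine Wp.weaken (T := 9 + ((3 + (20 + 4)) + 4)) (by omega) ?_
  refine Wp.seq (wp_loadVec mem s x 12 (by omega)) ?_
  rintro s1 ⟨h1, h2, h3⟩
  generalize s.vec mem (s.nat x) = v at h1 ⊢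
  have hF1 : Tracks F s1 := hF.congr (h2 _ (by omega) (by omega))
    fun r _ _ => h3 r (by omega) (by omega)
  refine wp_ifLexPos (by omega) (fun hv => ?_) (fun hv => ?_)
  · refine (wp_update mem _ 2 (by omega)).mono (by omega) ?_
    rintro s2 ⟨g1, g2, g3, g4⟩
    have e1 : ((Instr.realConst 11 0).apply mem s1).pair 12 = v := by
      rw [← h1]; simp [Instr.apply, Regs.pair]
    have e2 : ((Instr.realConst 11 0).apply mem s1).pair 2 = s1.pair 2 := by
      simp [Instr.apply, Regs.pair]
    have e3 : ((Instr.realConst 11 0).apply mem s1).pair 4 = s1.pair 4 := by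
      simp [Instr.apply, Regs.pair]
    rw [h1] at hv
    simp only [e1, e2, e3, Nat.reduceAdd] at g1 g2
    have g5 : ∀ r, 6 ≤ r → r ≤ 8 → s2.pair r = s1.pair r := by
      intro r k1 k2
      simp only [Regs.pair]
      rw [g4 r (by omega) (by omega) (by omega), g4 (r + 1) (by omega) (by omega) (by omega)]
      simp [Instr.apply, show r ≠ 11 by omega, show r ≠ 10 by omega]
    refine ⟨⟨?_, ?_, ?_⟩, ?_, ?_⟩
    · rw [g3]
      simp only [Instr.apply]
      rw [hF1.flag, Set.mem_insert_iff, not_or]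
      exact ⟨fun h => ⟨hv.ne_zero.symm, h⟩, fun h => h.2⟩
    · rw [g1, g2]; exact hF1.pos.insert hv
    · rw [g5 6 (by omega) (by omega), g5 8 (by omega) (by omega), Set.neg_insert]
      exact hF1.neg.insert_of_not hv.not_neg
    · intro r r1 r2
      rw [g3]
      exact h2 r (by omega) (by omega)
    · intro r r1
      rw [g4 r (by omega) (by omega) (by omega)]
      simp only [Instr.apply]
      rw [Function.update_of_ne (by omega)]
      exact h3 r (by omega) (by omega)
  rw [h1] at hv
  refine Wp.seq (R := fun s' => s'.pair 12 = v ∧ s'.pair 14 = -v ∧ s'.nat = s1.nat ∧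
    ∀ r, r < 11 → s'.real r = s1.real r) (Wp.instrs ?_) ?_
  · refine ⟨?_, ?_, ?_, ?_⟩
    · rw [← h1]; simp [applyAll, Instr.apply, Regs.pair]
    · rw [← h1]; simp [applyAll, Instr.apply, Regs.pair]
    · simp [applyAll, Instr.apply]
    · intro r hr
      simp [applyAll, Instr.apply, show r ≠ 11 by omega,
        show r ≠ 14 by omega, show r ≠ 15 by omega]
  rintro s2 ⟨g1, g2, g3, g4⟩
  have hF2 : Tracks F s2 := hF1.congr (by rw [g3]) fun r _ _ => g4 r (by omega)
  refine wp_ifLexPos (by omega) (fun hw => ?_) (fun hw => ?_)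
  · refine (wp_update mem _ 6 (by omega)).mono (by omega) ?_
    rintro s3 ⟨f1, f2, f3, f4⟩
    have e1 : ((Instr.realConst 11 0).apply mem s2).pair 12 = v := by
      rw [← g1]; simp [Instr.apply, Regs.pair]
    have e2 : ((Instr.realConst 11 0).apply mem s2).pair 6 = s2.pair 6 := by
      simp [Instr.apply, Regs.pair]
    have e3 : ((Instr.realConst 11 0).apply mem s2).pair 8 = s2.pair 8 := by
      simp [Instr.apply, Regs.pair]
    rw [g2] at hw
    simp only [e1, e2, e3, Nat.reduceAdd] at f1 f2
    have f5 : ∀ r, 2 ≤ r → r ≤ 4 → s3.pair r = s2.pair r := by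
      intro r k1 k2
      simp only [Regs.pair]
      rw [f4 r (by omega) (by omega) (by omega), f4 (r + 1) (by omega) (by omega) (by omega)]
      simp [Instr.apply, show r ≠ 11 by omega, show r ≠ 10 by omega]
    refine ⟨⟨?_, ?_, ?_⟩, ?_, ?_⟩
    · rw [f3]
      simp only [Instr.apply]
      rw [hF2.flag, Set.mem_insert_iff, not_or]
      refine ⟨fun h => ⟨?_, h⟩, fun h => h.2⟩
      rintro rfl
      exact not_lexPos_zero (by simpa using hw)
    · rw [f5 2 (by omega) (by omega), f5 4 (by omega) (by omega)]
      exact hF2.pos.insert_of_not hv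
    · rw [f1, f2, Set.neg_insert]
      -- The registers hold `c` and `d` without the sign change. Negating both arguments does not
      -- alter `cross`, so the same `update` serves both sides.
      have := hF2.neg.insert hw
      rw [cross_neg_neg, cross_neg_neg] at this
      rw [apply_ite Neg.neg, apply_ite Neg.neg]
      exact this
    · intro r r1 r2
      rw [f3]
      simp only [Instr.apply]
      rw [g3]
      exact h2 r (by omega) (by omega)
    · intro r r1
      rw [f4 r (by omega) (by omega) (by omega)]
      simp only [Instr.apply]
      rw [Function.update_of_ne (by omega), g4 r (by omega)]
      exact h3 r (by omega) (by omega)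
  · refine Wp.weaken (T := 2) (by omega) (Wp.instrs ?_)
    rw [g2] at hw
    have hv0 : v = 0 := ((lexPos_trichotomy v).resolve_left hv).resolve_right hw
    subst hv0
    have hp : ∀ r, r ≤ 8 → (applyAll mem [.natConst 5 1]
        ((Instr.realConst 11 0).apply mem s2)).pair r = s2.pair r := by
      intro r hr
      simp [applyAll, Instr.apply, Regs.pair, show r ≠ 11 by omega,
        show r ≠ 10 by omega]
    refine ⟨⟨?_, ?_, ?_⟩, ?_, ?_⟩
    · simp [applyAll, Instr.apply]
    · rw [hp 2 (by omega), hp 4 (by omega)]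
      exact hF2.pos.insert_of_not hv
    · rw [hp 6 (by omega), hp 8 (by omega), Set.neg_insert]
      exact hF2.neg.insert_of_not hw
    · intro r r1 r2
      simp only [applyAll, Instr.apply]
      rw [Function.update_of_ne r1, g3]
      exact h2 r (by omega) (by omega)
    · intro r r1
      simp only [applyAll, Instr.apply]
      rw [Function.update_of_ne (by omega), g4 r (by omega)]
      exact h3 r (by omega) (by omega)

/-! ### Binary search -/

/-- The vector from the query point to the `t`-th point of the current hull, with the sign of the
current chain. -/
noncomputable def Regs.signedVec (mem : Memory) (s : Regs) (t : ℕ) : ℝ × ℝ :=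
  s.real 10 • s.vec mem t

/-- The signed vectors with the index in register `12` and with the next one go to the real registers
`12`, …, `15`, the two terms of their determinant to `16` and `17`. -/
def loadEdge : Program :=
  .seq (loadVec 12 12) (.seq (instrs [.natConst 21 1, .natAdd 22 12 21])
    (.seq (loadVec 22 14) (instrs [.realMul 12 10 12, .realMul 13 10 13, .realMul 14 10 14,
      .realMul 15 10 15, .realMul 16 12 15, .realMul 17 13 14])))

theorem wp_loadEdge (mem : Memory) (s : Regs) :
    Wp mem loadEdge s 28 fun s' => s'.pair 12 = s.signedVec mem (s.nat 12) ∧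
      s'.pair 14 = s.signedVec mem (s.nat 12 + 1) ∧
      s'.real 16 - s'.real 17 = cross (s'.pair 12) (s'.pair 14) ∧
      (∀ r, r < 20 → s'.nat r = s.nat r) ∧ ∀ r, r < 11 → s'.real r = s.real r := by
  refine Wp.weaken (T := 9 + (3 + (9 + 7))) (by omega) ?_
  refine Wp.seq (wp_loadVec mem s 12 12 (by omega)) ?_
  rintro s1 ⟨h1, h2, h3⟩
  refine Wp.seq (R := fun s' => s'.nat 22 = s.nat 12 + 1 ∧ (∀ r, r < 20 → s'.nat r = s.nat r) ∧
    s'.real = s1.real) (Wp.instrs ⟨?_, ?_, ?_⟩) ?_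
  · simp [applyAll, Instr.apply, h2]
  · intro r hr
    simp [applyAll, Instr.apply, show r ≠ 21 by omega,
      show r ≠ 22 by omega, h2 r (by omega) (by omega)]
  · simp [applyAll, Instr.apply]
  rintro s2 ⟨g1, g2, g3⟩
  refine Wp.seq (wp_loadVec mem s2 22 14 (by omega)) ?_
  rintro s3 ⟨f1, f2, f3⟩
  have e2 : s3.pair 14 = s.vec mem (s.nat 12 + 1) := by
    rw [f1, g1]
    simp [Regs.vec, g2, Regs.pair, g3, h3]
  have e1 : s3.pair 12 = s.vec mem (s.nat 12) := by
    rw [← h1]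
    simp [Regs.pair, f3, g3]
  have e3 : s3.real 10 = s.real 10 := by
    rw [f3 _ (by omega) (by omega), g3, h3 _ (by omega) (by omega)]
  refine Wp.instrs ⟨?_, ?_, ?_, ?_, ?_⟩
  · rw [Regs.signedVec, ← e1, ← e3]
    ext <;> simp [applyAll, Instr.apply, Regs.pair]
  · rw [Regs.signedVec, ← e2, ← e3]
    ext <;> simp [applyAll, Instr.apply, Regs.pair]
  · simp [applyAll, Instr.apply, Regs.pair, cross]
  · intro r hr
    simp [applyAll, Instr.apply, f2 r (by omega) (by omega), g2 r hr]
  · intro r hr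
    simp [applyAll, Instr.apply, show r ≠ 12 by omega,
      show r ≠ 13 by omega, show r ≠ 14 by omega, show r ≠ 15 by omega, show r ≠ 16 by omega,
      show r ≠ 17 by omega, f3 r (by omega) (by omega), g3, h3 r (by omega) (by omega)]

/-- The branch `br` decides the property `P` of the edge in the real registers `12`, …, `15`. -/
def Decides (br : Program → Program → Program) (P : ℝ × ℝ → ℝ × ℝ → Prop) : Prop :=
  ∀ (mem : Memory) (s : Regs) (c d : Program) (T : ℕ) (Q : Regs → Prop),
    s.real 16 - s.real 17 = cross (s.pair 12) (s.pair 14) →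
    (P (s.pair 12) (s.pair 14) → Wp mem c ((Instr.realConst 11 0).apply mem s) T Q) →
    (¬ P (s.pair 12) (s.pair 14) → Wp mem d ((Instr.realConst 11 0).apply mem s) T Q) →
    Wp mem (br c d) s (T + 5) Q

/-- Branch on the next vector being positive. -/
def ifNextPos (c d : Program) : Program := ifLexPos 14 c d

/-- Branch on the next vector being positive and reached by a clockwise turn. -/
def ifPosFalling (c d : Program) : Program := ifLexPos 14 (.ite (.realLt 16 17) c d) d

/-- Branch on the vector being positive or being left by a counterclockwise turn. -/
def ifPosOrRising (c d : Program) : Program := ifLexPos 12 c (.ite (.realLt 17 16) c d)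

theorem decides_ifNextPos : Decides ifNextPos fun _ v => LexPos v := fun _ _ _ _ _ _ _ hc hd =>
  (wp_ifLexPos (by omega) hc hd).weaken (by omega)

theorem decides_ifPosFalling : Decides ifPosFalling fun u v => LexPos v ∧ cross u v < 0 := by
  intro mem s c d T Q h hc hd
  refine Wp.weaken (T := T + 1 + 4) (by omega) (wp_ifLexPos (by omega) (fun hv => ?_) fun hv =>
    (hd fun h => hv h.1).weaken (by omega))
  refine Wp.ite (fun e => hc ⟨hv, ?_⟩) (fun e => hd fun h' => e ?_)
  · rw [← h]
    simp only [Test.Holds, Instr.apply, ne_eq, Nat.reduceEqDiff, not_false_eq_true,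
      Function.update_of_ne] at e
    linarith
  · have := h'.2
    rw [← h] at this
    simp only [Test.Holds, Instr.apply, ne_eq, Nat.reduceEqDiff, not_false_eq_true,
      Function.update_of_ne]
    linarith

theorem decides_ifPosOrRising : Decides ifPosOrRising fun u v => LexPos u ∨ 0 < cross u v := by
  intro mem s c d T Q h hc hd
  refine Wp.weaken (T := T + 1 + 4) (by omega) (wp_ifLexPos (by omega)
    (fun hv => (hc (.inl hv)).weaken (by omega)) fun hv => ?_)
  refine Wp.ite (fun e => hc (.inr ?_)) (fun e => hd fun h' => e ?_)
  · rw [← h]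
    simp only [Test.Holds, Instr.apply, ne_eq, Nat.reduceEqDiff, not_false_eq_true,
      Function.update_of_ne] at e
    linarith
  · have := h'.resolve_left hv
    rw [← h] at this
    simp only [Test.Holds, Instr.apply, ne_eq, Nat.reduceEqDiff, not_false_eq_true,
      Function.update_of_ne]
    linarith

/-- Find the first index of the current chain that fails the test. -/
def bsearch (br : Program → Program → Program) : Program :=
  .seq (instrs [.natCopy 10 8, .natCopy 11 9])
    (.loop (.natLt 10 11) (.seq (instrs [.natAdd 12 10 11, .natHalf 12 12])
      (.seq loadEdge (br (instrs [.natConst 21 1, .natAdd 10 12 21]) (instrs [.natCopy 11 12])))))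

/-- The registers that a search leaves unchanged. -/
structure SearchFrame (s s' : Regs) : Prop where
  nat : ∀ r, r < 20 → r ≠ 10 → r ≠ 11 → r ≠ 12 → s'.nat r = s.nat r
  real : ∀ r, r < 11 → s'.real r = s.real r

theorem SearchFrame.trans {s s' s'' : Regs} (h : SearchFrame s s') (h' : SearchFrame s' s'') :
    SearchFrame s s'' where
  nat r h1 h2 h3 h4 := (h'.nat r h1 h2 h3 h4).trans (h.nat r h1 h2 h3 h4)
  real r h1 := (h'.real r h1).trans (h.real r h1)

theorem SearchFrame.signedVec {s s' : Regs} (h : SearchFrame s s') (mem : Memory) (t : ℕ) :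
    s'.signedVec mem t = s.signedVec mem t := by
  simp [Regs.signedVec, Regs.vec, Regs.pair, h.nat, h.real]

/-- The invariant keeps `P'` true just before the left end and false at the right end, unless these
are still the original ends. This yields a cut for any predicate, monotone or not. The interval
halves, so `N` rounds of at most 40 steps suffice. -/
theorem wp_bsearch (mem : Memory) (s : Regs) {br : Program → Program → Program}
    {P : ℝ × ℝ → ℝ × ℝ → Prop} (hP : Decides br P) (N : ℕ) (hle : s.nat 8 ≤ s.nat 9)
    (hN : s.nat 9 < 2 ^ N) :
    Wp mem (bsearch br) s (40 * N + 4) fun s' =>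
      IsCut (fun t => P (s.signedVec mem t) (s.signedVec mem (t + 1))) (s.nat 8) (s.nat 9)
        (s'.nat 10) ∧ SearchFrame s s' := by
  set P' : ℕ → Prop := fun t => P (s.signedVec mem t) (s.signedVec mem (t + 1)) with hP'
  let I : ℕ → Regs → Prop := fun N s' => SearchFrame s s' ∧ s.nat 8 ≤ s'.nat 10 ∧
    s'.nat 10 ≤ s'.nat 11 ∧ s'.nat 11 ≤ s.nat 9 ∧ s'.nat 11 - s'.nat 10 < 2 ^ N ∧
    (s'.nat 10 = s.nat 8 ∨ P' (s'.nat 10 - 1)) ∧ (s'.nat 11 = s.nat 9 ∨ ¬ P' (s'.nat 11))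
  refine Wp.weaken (T := 3 + (N * (39 + 1) + 1)) (by omega) ?_
  refine Wp.seq (R := I N) (Wp.instrs ?_) fun s1 hs1 => ?_
  · refine ⟨⟨fun r r1 r2 r3 r4 => ?_, fun r r1 => ?_⟩, ?_⟩
    · simp [applyAll, Instr.apply, r2, r3]
    · simp [applyAll, Instr.apply]
    · simp [applyAll, Instr.apply, hle]
      omega
  refine (Wp.loop (I := I) (T := 39) ?_ N s1 hs1).mono le_rfl ?_
  · rintro N s ⟨h1, h2, h3, h4, h5, h6, h7⟩ he
    simp only [Test.Holds] at he
    obtain ⟨N, rfl⟩ : ∃ N', N = N' + 1 := by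
      refine ⟨N - 1, ?_⟩
      rcases N with _ | N
      · rw [pow_zero] at h5; omega
      · omega
    rw [pow_succ] at h5
    refine ⟨N, rfl, ?_⟩
    refine Wp.weaken (T := 3 + (28 + (3 + 5))) (by omega) ?_
    refine Wp.seq (R := fun s' => s'.nat 12 = (s.nat 10 + s.nat 11) / 2 ∧
      s'.nat 10 = s.nat 10 ∧ s'.nat 11 = s.nat 11 ∧ SearchFrame s s')
      (Wp.instrs ⟨?_, ?_, ?_, fun r r1 r2 r3 r4 => ?_, fun r r1 => ?_⟩) ?_
    · simp [applyAll, Instr.apply]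
    · simp [applyAll, Instr.apply]
    · simp [applyAll, Instr.apply]
    · simp [applyAll, Instr.apply, r4]
    · simp [applyAll, Instr.apply]
    rintro s2 ⟨g1, g2, g3, g4⟩
    refine Wp.seq (wp_loadEdge mem s2) ?_
    rintro s3 ⟨f1, f2, f3, f4, f5⟩
    have hf := (h1.trans g4).trans (s'' := s3) ⟨fun r r1 _ _ _ => f4 r r1, f5⟩
    have hPs : P (s3.pair 12) (s3.pair 14) ↔ P' (s2.nat 12) := by
      rw [f1, f2, (h1.trans g4).signedVec, (h1.trans g4).signedVec]
    have k1 := f4 10 (by omega)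
    have k2 := f4 11 (by omega)
    have k3 := f4 12 (by omega)
    refine hP mem s3 _ _ 3 _ f3 (fun hp => Wp.instrs ?_)
      fun hp => Wp.weaken (T := 2) (by omega) (Wp.instrs ?_)
    · rw [hPs] at hp
      refine ⟨⟨fun r r1 r2 r3 r4 => ?_, fun r r1 => ?_⟩, ?_⟩
      · simp [applyAll, Instr.apply, r2, show r ≠ 21 by omega,
          hf.nat r r1 r2 r3 r4]
      · simp [applyAll, Instr.apply, show r ≠ 11 by omega, hf.real r r1]
      · simp [applyAll, Instr.apply, k2, k3, hp, g3, h7]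
        omega
    · rw [hPs] at hp
      refine ⟨⟨fun r r1 r2 r3 r4 => ?_, fun r r1 => ?_⟩, ?_⟩
      · simp [applyAll, Instr.apply, r3, hf.nat r r1 r2 r3 r4]
      · simp [applyAll, Instr.apply, show r ≠ 11 by omega, hf.real r r1]
      · simp [applyAll, Instr.apply, k1, k3, hp, g2, h6]
        omega
  · rintro s' ⟨⟨_, h1, h2, h3, h4, -, h6, h7⟩, he⟩
    simp only [Test.Holds, not_lt] at he
    have he' : s'.nat 11 = s'.nat 10 := by omega
    rw [he'] at h4 h7
    exact ⟨⟨h2, h4, h6, h7⟩, h1⟩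

/-! ### Chains, nodes, and the whole query -/

/-- Feed six candidates of the current chain. -/
def chain : Program :=
  .seq (feed 8) (.seq (feed 9) (.seq (bsearch ifPosFalling) (.seq (feed 10)
    (.seq (bsearch ifPosOrRising) (.seq (feed 10) (.seq (bsearch ifNextPos) (.seq (feed 10)
      (.seq (.ite (.natLt 10 9) (instrs [.natConst 21 1, .natAdd 10 10 21]) (instrs []))
        (feed 10)))))))))

/-- The registers that the work on a chain leaves unchanged. -/
structure ChainFrame (s s' : Regs) : Prop where
  nat : ∀ r, r < 20 → r ≠ 5 → r ≠ 10 → r ≠ 11 → r ≠ 12 → s'.nat r = s.nat r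
  real : ∀ r, (r < 2 ∨ r = 10) → s'.real r = s.real r

theorem ChainFrame.trans {s s' s'' : Regs} (h : ChainFrame s s') (h' : ChainFrame s' s'') :
    ChainFrame s s'' where
  nat r h1 h2 h3 h4 h5 := (h'.nat r h1 h2 h3 h4 h5).trans (h.nat r h1 h2 h3 h4 h5)
  real r h1 := (h'.real r h1).trans (h.real r h1)

theorem ChainFrame.vec {s s' : Regs} (h : ChainFrame s s') (mem : Memory) (t : ℕ) :
    s'.vec mem t = s.vec mem t := by
  simp [Regs.vec, Regs.pair, h.nat, h.real]

theorem ChainFrame.signedVec {s s' : Regs} (h : ChainFrame s s') (mem : Memory) (t : ℕ) :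
    s'.signedVec mem t = s.signedVec mem t := by
  rw [Regs.signedVec, Regs.signedVec, h.vec, h.real 10 (.inr rfl)]

theorem SearchFrame.chainFrame {s s' : Regs} (h : SearchFrame s s') : ChainFrame s s' where
  nat r h1 _ h3 h4 h5 := h.nat r h1 h3 h4 h5
  real r h1 := h.real r (by omega)

theorem SearchFrame.tracks {s s' : Regs} (h : SearchFrame s s') {F : Set (ℝ × ℝ)}
    (hF : Tracks F s) : Tracks F s' :=
  hF.congr (h.nat 5 (by omega) (by omega) (by omega) (by omega)) fun r _ _ => h.real r (by omega)

theorem wp_feed_chain (mem : Memory) {s₀ s : Regs} (x : ℕ) {F : Set (ℝ × ℝ)}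
    (hF : Tracks F s) (hs : ChainFrame s₀ s) :
    Wp mem (feed x) s 40 fun s' => Tracks (insert (s₀.vec mem (s.nat x)) F) s' ∧
      ChainFrame s₀ s' ∧ s'.nat 10 = s.nat 10 := by
  refine (wp_feed mem s x hF).mono le_rfl ?_
  rintro s' ⟨h1, h2, h3⟩
  rw [hs.vec] at h1
  exact ⟨h1, hs.trans ⟨fun r r1 r2 _ _ _ => h2 r r2 r1, h3⟩, h2 10 (by omega) (by omega)⟩

theorem wp_bsearch_chain (mem : Memory) {s₀ s : Regs} {br : Program → Program → Program}
    {P : ℝ × ℝ → ℝ × ℝ → Prop} (hP : Decides br P) (N : ℕ) (hle : s₀.nat 8 ≤ s₀.nat 9)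
    (hN : s₀.nat 9 < 2 ^ N) {F : Set (ℝ × ℝ)} (hF : Tracks F s) (hs : ChainFrame s₀ s) :
    Wp mem (bsearch br) s (40 * N + 4) fun s' =>
      IsCut (fun t => P (s₀.signedVec mem t) (s₀.signedVec mem (t + 1))) (s₀.nat 8) (s₀.nat 9)
        (s'.nat 10) ∧ Tracks F s' ∧ ChainFrame s₀ s' := by
  have h8 : s.nat 8 = s₀.nat 8 := hs.nat 8 (by omega) (by omega) (by omega) (by omega) (by omega)
  have h9 : s.nat 9 = s₀.nat 9 := hs.nat 9 (by omega) (by omega) (by omega) (by omega) (by omega)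
  refine (wp_bsearch mem s hP N (by omega) (by omega)).mono le_rfl ?_
  rintro s' ⟨h1, h2⟩
  simp only [hs.signedVec, h8, h9] at h1
  exact ⟨h1, h2.tracks hF, hs.trans h2.chainFrame⟩

/-- Three searches and six feeds; the set `G` adds exactly the six candidates of
`ClockwiseChain.spans`. Extra candidates are harmless because they are themselves vertices of the
chain. -/
theorem wp_chain (mem : Memory) (s : Regs) (N : ℕ) (hle : s.nat 8 ≤ s.nat 9)
    (hN : s.nat 9 < 2 ^ N) {F : Set (ℝ × ℝ)} (hF : Tracks F s) (hσ : s.real 10 = 1 ∨ s.real 10 = -1)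
    (hC : ClockwiseChain (s.signedVec mem) (s.nat 8) (s.nat 9)) :
    Wp mem chain s (120 * N + 260) fun s' => ∃ G, Tracks G s' ∧ F ⊆ G ∧
      G ⊆ F ∪ s.vec mem '' Set.Icc (s.nat 8) (s.nat 9) ∧
      (0 ∈ G ∨ ∀ t ∈ Set.Icc (s.nat 8) (s.nat 9), Spans G (s.vec mem t)) ∧ ChainFrame s s' := by
  have hs0 : ChainFrame s s := ⟨fun _ _ _ _ _ _ => rfl, fun _ _ => rfl⟩
  refine Wp.weaken (T := 40 + (40 + ((40 * N + 4) + (40 + ((40 * N + 4) + (40 + ((40 * N + 4) +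
    (40 + ((3 + 1) + 40))))))))) (by omega) ?_
  refine Wp.seq (wp_feed_chain mem 8 hF hs0) ?_
  rintro s1 ⟨t1, f1, -⟩
  refine Wp.seq (wp_feed_chain mem 9 t1 f1) ?_
  rintro s2 ⟨t2, f2, -⟩
  refine Wp.seq (wp_bsearch_chain mem decides_ifPosFalling N hle hN t2 f2) ?_
  rintro s3 ⟨c3, t3, f3⟩
  refine Wp.seq (wp_feed_chain mem 10 t3 f3) ?_
  rintro s4 ⟨t4, f4, -⟩
  refine Wp.seq (wp_bsearch_chain mem decides_ifPosOrRising N hle hN t4 f4) ?_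
  rintro s5 ⟨c5, t5, f5⟩
  refine Wp.seq (wp_feed_chain mem 10 t5 f5) ?_
  rintro s6 ⟨t6, f6, -⟩
  refine Wp.seq (wp_bsearch_chain mem decides_ifNextPos N hle hN t6 f6) ?_
  rintro s7 ⟨c7, t7, f7⟩
  refine Wp.seq (wp_feed_chain mem 10 t7 f7) ?_
  rintro s8 ⟨t8, f8, e8⟩
  have h9 : s1.nat 9 = s.nat 9 := f1.nat 9 (by omega) (by omega) (by omega) (by omega) (by omega)
  have h9' : s8.nat 9 = s.nat 9 := f8.nat 9 (by omega) (by omega) (by omega) (by omega) (by omega)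
  refine Wp.seq (R := fun s' => s'.nat 10 = (if s7.nat 10 < s.nat 9 then s7.nat 10 + 1
      else s7.nat 10) ∧ SearchFrame s8 s') (Wp.ite (fun e => Wp.instrs ?_)
      fun e => Wp.weaken (T := 1) (by omega) (Wp.instrs ?_)) ?_
  · simp only [Test.Holds, e8, h9'] at e
    rw [if_pos e]
    refine ⟨by simp [applyAll, Instr.apply, e8], fun r r1 r2 _ _ => ?_, fun r _ => ?_⟩
    · simp [applyAll, Instr.apply, r2, show r ≠ 21 by omega]
    · simp [applyAll, Instr.apply]
  · simp only [Test.Holds, e8, h9'] at e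
    rw [if_neg e]
    exact ⟨e8, fun r _ _ _ _ => rfl, fun r _ => rfl⟩
  rintro s9 ⟨e9, f9⟩
  refine (wp_feed_chain mem 10 (f9.tracks t8) (f8.trans f9.chainFrame)).mono le_rfl ?_
  rintro s' ⟨t', f', -⟩
  rw [e9, h9] at t'
  set G := insert (s.vec mem (if s7.nat 10 < s.nat 9 then s7.nat 10 + 1 else s7.nat 10))
    (insert (s.vec mem (s7.nat 10)) (insert (s.vec mem (s5.nat 10)) (insert (s.vec mem (s3.nat 10))
      (insert (s.vec mem (s.nat 9)) (insert (s.vec mem (s.nat 8)) F))))) with hG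
  have m1 : s.vec mem (s.nat 8) ∈ G := by simp [hG]
  have m2 : s.vec mem (s.nat 9) ∈ G := by simp [hG]
  have m3 : s.vec mem (s3.nat 10) ∈ G := by simp [hG]
  have m4 : s.vec mem (s5.nat 10) ∈ G := by simp [hG]
  have m5 : s.vec mem (s7.nat 10) ∈ G := by simp [hG]
  have m6 : s.vec mem (if s7.nat 10 < s.nat 9 then s7.nat 10 + 1 else s7.nat 10) ∈ G := by simp [hG]
  refine ⟨G, t', ?_, ?_, ?_, f'⟩
  · intro x hx
    simp [hG, hx]
  · have hi : ∀ t, s.nat 8 ≤ t → t ≤ s.nat 9 →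
        s.vec mem t ∈ F ∪ s.vec mem '' Set.Icc (s.nat 8) (s.nat 9) :=
      fun t h1 h2 => .inr ⟨t, ⟨h1, h2⟩, rfl⟩
    simp only [hG, Set.insert_subset_iff]
    refine ⟨hi _ ?_ ?_, hi _ c7.1 c7.2.1, hi _ c5.1 c5.2.1, hi _ c3.1 c3.2.1, hi _ hle le_rfl,
      hi _ le_rfl hle, Set.subset_union_left⟩
    · have := c7.1; split_ifs <;> omega
    · have := c7.2.1; split_ifs <;> omega
  · rcases hσ with hσ | hσ
    · have hw : s.signedVec mem = s.vec mem := by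
        funext t; rw [Regs.signedVec, hσ, one_smul]
      rw [hw] at hC c3 c5 c7
      exact (hC.spans c3 c7 c5 m1 m2 m3 m5 m6 m4).imp_right fun h t ht => h t ht.1 ht.2
    · have hw : s.signedVec mem = fun t => -s.vec mem t := by
        funext t; rw [Regs.signedVec, hσ, neg_one_smul]
      rw [hw] at hC c3 c5 c7
      -- On the reflected chain the searches see negated vectors while the feeds see the original
      -- ones; `Spans.neg` undoes the reflection.
      refine (hC.spans (F := -G) c3 c7 c5 ?_ ?_ ?_ ?_ ?_ ?_).imp ?_ fun h t ht => ?_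
      · simpa using m1
      · simpa using m2
      · simpa using m3
      · simpa using m5
      · simpa using m6
      · simpa using m4
      · simp
      · simpa using (h t ht.1 ht.2).neg

/-- Feed the candidates of both chains of the node in register `6`. -/
def node : Program :=
  .seq (instrs [.natConst 20 5, .natAdd 20 20 6, .natLoad 7 20, .natConst 21 1, .natAdd 20 20 21,
    .natLoad 14 20, .natAdd 20 20 21, .natLoad 13 20, .natConst 8 0, .natCopy 9 13,
    .realConst 10 1])
    (.seq chain (.seq (instrs [.natCopy 8 13, .natConst 21 1, .natSub 9 14 21, .realConst 10 (-1)])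
      chain))

theorem convex_preimage_sub {K : Set (ℝ × ℝ)} (hK : Convex ℝ K) (q : ℝ × ℝ) :
    Convex ℝ {z | z - q ∈ K} := by
  have := hK.translate_preimage_left (-q)
  simp only [sub_eq_add_neg]
  exact this

/-- The two chains meet at the minimum and together contain every hull vertex, so unless `q` was met
the spanned directions contain all vertices, and their convex hull contains every point of the node.
-/
theorem wp_node (mem : Memory) (s : Regs) (N : ℕ) {F S : Set (ℝ × ℝ)} (hS : S.Finite)
    (hN : S.ncard ≤ 2 ^ N) (hF : Tracks F s)
    (hH : IsClockwiseHull S (mem.nat (s.nat 6 + 6)) (mem.point (mem.nat (s.nat 6 + 5)))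
      (mem.nat (s.nat 6 + 7))) :
    Wp mem node s (240 * N + 540) fun s' => ∃ G, Tracks G s' ∧ F ⊆ G ∧
      (∀ x ∈ G, x ∈ F ∨ s.pair 0 + x ∈ S) ∧
      (0 ∈ G ∨ ∀ z ∈ S, z - s.pair 0 ∈ convexHull ℝ {x | Spans G x}) ∧
      (∀ r, r < 5 → s'.nat r = s.nat r) ∧ ∀ r, r < 2 → s'.real r = s.real r := by
  have hcard := (hH.ncard_le hS).trans hN
  have hsub := hH.subset_convexHull hS
  have hlower := hH.lower (s.pair 0)
  have hupper := hH.upper (s.pair 0)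
  have hm := hH.min_lt
  have hmem : ∀ t, t < mem.nat (s.nat 6 + 6) →
      mem.point (mem.nat (s.nat 6 + 5)) t ∈ S := fun t ht => hH.mem ht
  generalize hv : mem.nat (s.nat 6 + 5) = base at *
  generalize hh : mem.nat (s.nat 6 + 6) = h at *
  generalize hm' : mem.nat (s.nat 6 + 7) = m at *
  refine Wp.weaken (T := 12 + ((120 * N + 260) + (5 + (120 * N + 260)))) (by omega) ?_
  refine Wp.seq (R := fun s' => s'.nat 7 = base ∧ s'.nat 8 = 0 ∧ s'.nat 9 = m ∧ s'.nat 13 = m ∧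
    s'.nat 14 = h ∧ s'.real 10 = 1 ∧ (∀ r, r < 6 → s'.nat r = s.nat r) ∧
    ∀ r, r < 10 → s'.real r = s.real r) (Wp.instrs ?_) ?_
  · have a1 : 5 + s.nat 6 = s.nat 6 + 5 := by omega
    have a2 : 5 + s.nat 6 + 1 = s.nat 6 + 6 := by omega
    have a3 : 5 + s.nat 6 + 1 + 1 = s.nat 6 + 7 := by omega
    refine ⟨?_, ?_, ?_, ?_, ?_, ?_, fun r hr => ?_, fun r hr => ?_⟩
    · simp [applyAll, Instr.apply, a1, hv]
    · simp [applyAll, Instr.apply]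
    · simp [applyAll, Instr.apply, a3, hm']
    · simp [applyAll, Instr.apply, a3, hm']
    · simp [applyAll, Instr.apply, a2, hh]
    · simp [applyAll, Instr.apply]
    · simp [applyAll, Instr.apply, show r ≠ 20 by omega,
        show r ≠ 21 by omega, show r ≠ 7 by omega, show r ≠ 8 by omega, show r ≠ 9 by omega,
        show r ≠ 13 by omega, show r ≠ 14 by omega]
    · simp [applyAll, Instr.apply, show r ≠ 10 by omega]
  rintro s1 ⟨i1, i2, i3, i4, i5, i6, i7, i8⟩
  have hq : s1.pair 0 = s.pair 0 := by simp [Regs.pair, i8]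
  have hvec : s1.vec mem = fun t => mem.point base t - s.pair 0 := by
    funext t; rw [Regs.vec, i1, hq]
  refine Wp.seq (wp_chain mem s1 N (by omega) (by omega)
    (hF.congr (i7 5 (by omega)) fun r _ h => i8 r h) (.inl i6) ?_) ?_
  · have : s1.signedVec mem = fun t => mem.point base t - s.pair 0 := by
      funext t; rw [Regs.signedVec, i6, one_smul, hvec]
    rw [this, i2, i3]
    exact hlower
  rintro s2 ⟨G, hG, hFG, hGs, hspan, hfr⟩
  rw [hvec, i2, i3] at hGs hspan
  refine Wp.seq (R := fun s' => s'.nat 7 = base ∧ s'.nat 8 = m ∧ s'.nat 9 = h - 1 ∧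
    s'.real 10 = -1 ∧ (∀ r, r < 6 → s'.nat r = s2.nat r) ∧
    ∀ r, r < 10 → s'.real r = s2.real r) (Wp.instrs ?_) ?_
  · refine ⟨?_, ?_, ?_, ?_, fun r hr => ?_, fun r hr => ?_⟩
    · simp [applyAll, Instr.apply, hfr.nat, i1]
    · simp [applyAll, Instr.apply, hfr.nat, i4]
    · simp [applyAll, Instr.apply, hfr.nat, i5]
    · simp [applyAll, Instr.apply]
    · simp [applyAll, Instr.apply, 
        show r ≠ 21 by omega, show r ≠ 8 by omega, show r ≠ 9 by omega]
    · simp [applyAll, Instr.apply, show r ≠ 10 by omega]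
  rintro s3 ⟨j1, j2, j3, j4, j5, j6⟩
  have hq3 : s3.pair 0 = s.pair 0 := by
    rw [← hq]; simp [Regs.pair, j6, hfr.real]
  have hvec3 : s3.vec mem = fun t => mem.point base t - s.pair 0 := by
    funext t; rw [Regs.vec, j1, hq3]
  refine (wp_chain mem s3 N (by omega) (by omega)
    (hG.congr (j5 5 (by omega)) fun r _ h => j6 r h) (.inr j4) ?_).mono le_rfl ?_
  · have : s3.signedVec mem = fun t => -(mem.point base t - s.pair 0) := by
      funext t; rw [Regs.signedVec, j4, neg_one_smul, hvec3]
    rw [this, j2, j3]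
    exact hupper
  rintro s4 ⟨G', hG', hGG', hGs', hspan', hfr'⟩
  rw [hvec3, j2, j3] at hGs' hspan'
  refine ⟨G', hG', hFG.trans hGG', ?_, ?_, fun r hr => ?_, fun r hr => ?_⟩
  · intro x hx
    rcases hGs' hx with hx | ⟨t, ht, rfl⟩
    · rcases hGs hx with hx | ⟨t, ht, rfl⟩
      · exact .inl hx
      · right
        rw [add_sub_cancel]
        exact hmem t (by have := ht.2; omega)
    · right
      simp only [add_sub_cancel]
      exact hmem t (by have := ht.2; omega)
  · rcases hspan with h0 | hspan
    · exact .inl (hGG' h0)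
    rcases hspan' with h0 | hspan'
    · exact .inl h0
    right
    have hmin := convexHull_min (s := mem.point base '' {t | t < h}) ?_
      (convex_preimage_sub (convex_convexHull ℝ {x | Spans G' x}) (s.pair 0))
    · exact fun z hz => hmin (hsub hz)
    · rintro _ ⟨t, ht, rfl⟩
      refine _root_.subset_convexHull ℝ _ ?_
      by_cases htm : t ≤ m
      · exact (hspan t ⟨Nat.zero_le _, htm⟩).mono hGG'
      · exact hspan' t ⟨by omega, by have : t < h := ht; omega⟩
  · rw [hfr'.nat r (by omega) (by omega) (by omega) (by omega) (by omega), j5 r (by omega),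
      hfr.nat r (by omega) (by omega) (by omega) (by omega) (by omega), i7 r (by omega)]
  · rw [hfr'.real r (.inl hr), j6 r (by omega), hfr.real r (.inl hr), i8 r (by omega)]

/-! ### Deciding and reporting the answer. -/

/-- Return the points in the directions in the real registers `u`, `u + 1` and `v`, `v + 1`. -/
def report (u v : ℕ) : Program := instrs
  [.realAdd 12 0 u, .realAdd 13 1 (u + 1), .realAdd 14 0 v, .realAdd 15 1 (v + 1), .realCopy 0 12,
    .realCopy 1 13, .realCopy 2 14, .realCopy 3 15, .natConst 0 1]

theorem wp_report (mem : Memory) (s : Regs) (u v : ℕ) (hu : u < 11) (hv : v < 11)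
    {K : Set (ℝ × ℝ)} (h : TangentPair K (s.pair 0) (s.pair u) (s.pair v)) :
    Wp mem (report u v) s 10 (AnswersTangentQuery K (s.pair 0)) := by
  obtain ⟨h1, h2, h3, h4⟩ := h
  refine Wp.instrs (.inr ⟨h1, ?_, ?_⟩)
  · simp [applyAll, Instr.apply]
  have e1 : (applyAll mem [.realAdd 12 0 u, .realAdd 13 1 (u + 1), .realAdd 14 0 v,
      .realAdd 15 1 (v + 1), .realCopy 0 12, .realCopy 1 13, .realCopy 2 14, .realCopy 3 15,
      .natConst 0 1] s).pair 0 = s.pair 0 + s.pair u := by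
    ext <;> simp [applyAll, Instr.apply, Regs.pair, show u ≠ 11 by omega]
  have e2 : (applyAll mem [.realAdd 12 0 u, .realAdd 13 1 (u + 1), .realAdd 14 0 v,
      .realAdd 15 1 (v + 1), .realCopy 0 12, .realCopy 1 13, .realCopy 2 14, .realCopy 3 15,
      .natConst 0 1] s).pair 2 = s.pair 0 + s.pair v := by
    ext <;> simp [applyAll, Instr.apply, Regs.pair, show v ≠ 11 by omega, show v ≠ 12 by omega,
      show v ≠ 13 by omega]
  rw [← e1] at h2 h4
  rw [← e2] at h3 h4
  exact ⟨h2, h3, h4⟩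

/-- Branch on the vector in the real registers `x`, `x + 1` being zero. -/
def ifZero (x : ℕ) (c d : Program) : Program :=
  .ite (.realEq x 11) (.ite (.realEq (x + 1) 11) c d) d

theorem wp_ifZero {mem : Memory} {s : Regs} {x : ℕ} {c d : Program} {T : ℕ} {Q : Regs → Prop}
    (h11 : s.real 11 = 0) (hc : s.pair x = 0 → Wp mem c s T Q) (hd : s.pair x ≠ 0 → Wp mem d s T Q) :
    Wp mem (ifZero x c d) s (T + 2) Q := by
  refine Wp.ite (fun e1 => Wp.ite (fun e2 => hc ?_) (fun e2 => hd fun h => e2 ?_))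
    (fun e1 => Wp.weaken (by omega) (hd fun h => e1 ?_))
  · exact Prod.ext (e1.trans h11) (e2.trans h11)
  · exact (congrArg Prod.snd h).trans h11.symm
  · exact (congrArg Prod.fst h).trans h11.symm

/-- Decide the query from the extreme directions. -/
def answer : Program :=
  .seq (instrs [.natConst 20 0, .realMul 12 8 3, .realMul 13 9 2, .realMul 14 6 5, .realMul 15 7 4,
    .realConst 11 0])
    (.ite (.natLt 20 5) (instrs [.natConst 0 0])
      (.ite (.realLt 12 13) (report 2 8) (.ite (.realLt 15 14) (report 6 4)
        (ifZero 2 (report 6 8) (ifZero 6 (report 2 4) (instrs [.natConst 0 0]))))))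

theorem wp_answer (mem : Memory) (s : Regs) {K F : Set (ℝ × ℝ)} (hK : Convex ℝ K)
    (hne : K.Nonempty) (hF : Tracks F s) (hFK : ∀ x ∈ F, s.pair 0 + x ∈ K)
    (hKF : 0 ∈ F ∨ ∀ z ∈ K, z - s.pair 0 ∈ convexHull ℝ {x | Spans F x}) :
    Wp mem answer s 30 (AnswersTangentQuery K (s.pair 0)) := by
  refine Wp.weaken (T := 7 + (((((10 + 2) + 2) + 1) + 1) + 1)) (by omega) ?_
  refine Wp.seq (R := fun s' => s'.nat 20 = 0 ∧ s'.real 12 = s.real 8 * s.real 3 ∧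
    s'.real 13 = s.real 9 * s.real 2 ∧ s'.real 14 = s.real 6 * s.real 5 ∧
    s'.real 15 = s.real 7 * s.real 4 ∧ s'.real 11 = 0 ∧ s'.nat 5 = s.nat 5 ∧
    ∀ r, r < 11 → s'.real r = s.real r) (Wp.instrs ?_) ?_
  · refine ⟨?_, ?_, ?_, ?_, ?_, ?_, ?_, fun r hr => ?_⟩
    all_goals simp [applyAll, Instr.apply]
    simp [show r ≠ 11 by omega, show r ≠ 12 by omega, show r ≠ 13 by omega, show r ≠ 14 by omega,
      show r ≠ 15 by omega]
  rintro s1 ⟨h20, h12, h13, h14, h15, h11, h5, hr⟩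
  have hp : ∀ r, r < 10 → s.pair r = s1.pair r := by
    intro r h
    simp [Regs.pair, hr r (by omega), hr (r + 1) (by omega)]
  have h12' : s1.real 12 - s1.real 13 = cross (s1.pair 8) (s1.pair 2) := by
    rw [← hp 8 (by omega), ← hp 2 (by omega), h12, h13]
    simp [Regs.pair, cross]
  have h14' : s1.real 14 - s1.real 15 = cross (s1.pair 6) (s1.pair 4) := by
    rw [← hp 6 (by omega), ← hp 4 (by omega), h14, h15]
    simp [Regs.pair, cross]
  replace hF : Tracks F s1 := hF.congr h5 fun r _ h => hr r (by omega)
  rw [hp 0 (by omega)] at *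
  clear hp
  refine Wp.ite (fun e => Wp.weaken (T := 2) (by omega) (Wp.instrs (.inl ⟨?_, ?_⟩))) (fun e => ?_)
  · simp only [Test.Holds, h20] at e
    have h0 : (0 : ℝ × ℝ) ∈ F := by
      by_contra hc
      have := hF.flag.2 hc
      omega
    simpa using hFK 0 h0
  · simp [applyAll, Instr.apply]
  simp only [Test.Holds, h20, not_lt, nonpos_iff_eq_zero] at e
  obtain ⟨t1, t2, t3⟩ := tangents_of_extremes hK hne hFK
    (hKF.resolve_left (hF.flag.1 e)) hF.pos hF.neg
  refine Wp.ite (fun e1 => (wp_report mem s1 2 8 (by omega) (by omega) (t1 ?_)).weaken (by omega))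
    (fun e1 => Wp.ite
      (fun e2 => (wp_report mem s1 6 4 (by omega) (by omega) (t2 ?_)).weaken (by omega))
      (fun e2 => ?_))
  · simp only [Test.Holds] at e1; linarith
  · simp only [Test.Holds] at e2; linarith
  simp only [Test.Holds] at e1 e2
  obtain ⟨t4, t5, t6⟩ := t3 (by linarith) (by linarith)
  refine wp_ifZero h11 (fun z1 => (wp_report mem s1 6 8 (by omega) (by omega) (t4 z1)).weaken
    (by omega)) (fun z1 => wp_ifZero h11
      (fun z2 => wp_report mem s1 2 4 (by omega) (by omega) (t5 z1 z2))
      (fun z2 => Wp.weaken (T := 2) (by omega) (Wp.instrs (.inl ⟨t6 z1 z2, ?_⟩))))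
  simp [applyAll, Instr.apply]

/-! ### Climbing the tree over the window. -/

/-- The program for tangent queries. -/
def tangentQuery : Program :=
  .seq (instrs [.natAdd 20 0 1, .natLoad 3 20, .natAdd 20 0 2, .natLoad 4 20, .natConst 20 1,
    .natAdd 2 2 20])
    (.seq (.loop (.natLt 1 2) (.seq (instrs [.natCopy 6 3]) (.seq node (.seq (instrs [.natCopy 6 4])
      (.seq node (instrs [.natConst 20 4, .natAdd 3 3 20, .natLoad 3 3, .natLoad 3 3,
        .natConst 20 3, .natAdd 4 4 20, .natLoad 4 4, .natLoad 4 4, .natConst 20 1, .natAdd 1 1 20,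
        .natHalf 1 1, .natHalf 2 2]))))))
      answer)

/-- Only blocks that lie entirely inside the window are visited, so they are never cut off at `n`
and never exceed the height of the tree. -/
theorem isNode_of_mul_le {n k b : ℕ} (h : (b + 1) * 2 ^ k ≤ n) : IsNode n k b := by
  have h1 : 0 < 2 ^ k := by positivity
  rw [add_mul, one_mul] at h
  refine ⟨?_, by omega⟩
  have h2 : 2 ^ k ≤ 2 ^ Nat.clog 2 n :=
    (show 2 ^ k ≤ n by omega).trans (Nat.le_pow_clog (by omega) n)
  exact (Nat.pow_le_pow_iff_right (by omega)).1 h2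

/-- The state of the traversal at height `k`, where the blocks `l, …, r - 1` are still to be
covered. -/
structure AtLevel {n : ℕ} (p : Fin n → ℝ × ℝ) (addr : ℕ → ℕ → ℕ) (i j : Fin n) (q : ℝ × ℝ)
    (F : Set (ℝ × ℝ)) (k l r : ℕ) (s : Regs) : Prop where
  left : s.nat 1 = l
  right : s.nat 2 = r
  query : s.pair 0 = q
  ptr : l < r → s.nat 3 = addr k l ∧ s.nat 4 = addr k (r - 1)
  le_left : i ≤ l * 2 ^ k
  right_le : r * 2 ^ k ≤ j + 1
  tracks : Tracks F s
  mem_hull : ∀ x ∈ F, q + x ∈ convexHull ℝ (p '' Set.Icc i j)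
  covered : 0 ∈ F ∨ ∀ t : Fin n, i ≤ t → t ≤ j → ((t : ℕ) < l * 2 ^ k ∨ r * 2 ^ k ≤ t) →
    p t - q ∈ convexHull ℝ {x | Spans F x}

theorem canonicalSubset_subset {n : ℕ} (p : Fin n → ℝ × ℝ) {i j : Fin n} {k b : ℕ}
    (h1 : i ≤ b * 2 ^ k) (h2 : (b + 1) * 2 ^ k ≤ j + 1) :
    canonicalSubset p k b ⊆ p '' Set.Icc i j := by
  refine Set.image_mono fun t ht => ⟨?_, ?_⟩
  · exact Fin.le_def.2 (h1.trans ht.1)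
  · exact Fin.le_def.2 (by have := ht.2; omega)

/-- Both outermost blocks are fed whatever their parity. They lie in the window, so feeding more
than necessary, or the same block twice, does no harm. Afterwards the rounded ends `⌈l / 2⌉` and `⌊r
/ 2⌋` of the next level leave out only points of these two blocks. -/
theorem wp_level {n : ℕ} {mem : Memory} {p : Fin n → ℝ × ℝ} {addr : ℕ → ℕ → ℕ}
    (hrec : ∀ k b, IsNode n k b → IsRecord mem p addr k b) {i j : Fin n} {q : ℝ × ℝ}
    {F : Set (ℝ × ℝ)} {k l r : ℕ} {s : Regs} (h : AtLevel p addr i j q F k l r s) (hlr : l < r)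
    {M : ℕ} (hM : (j : ℕ) + 1 - i < 2 ^ M) :
    Wp mem (.seq (instrs [.natCopy 6 3]) (.seq node (.seq (instrs [.natCopy 6 4])
      (.seq node (instrs [.natConst 20 4, .natAdd 3 3 20, .natLoad 3 3, .natLoad 3 3,
        .natConst 20 3, .natAdd 4 4 20, .natLoad 4 4, .natLoad 4 4, .natConst 20 1, .natAdd 1 1 20,
        .natHalf 1 1, .natHalf 2 2]))))) s (480 * M + 1100)
      fun s' => ∃ F', AtLevel p addr i j q F' (k + 1) ((l + 1) / 2) (r / 2) s' := by
  have hsub : ∀ b, l ≤ b → b < r → i ≤ b * 2 ^ k ∧ (b + 1) * 2 ^ k ≤ j + 1 := fun b h1 h2 =>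
    ⟨h.le_left.trans (Nat.mul_le_mul_right _ h1), (Nat.mul_le_mul_right _ h2).trans h.right_le⟩
  have hnode : ∀ b, b < r → IsNode n k b := fun b hb => isNode_of_mul_le
    (((Nat.mul_le_mul_right _ hb).trans h.right_le).trans j.2)
  have hcard : ∀ b, (canonicalSubset p k b).ncard ≤ 2 ^ M := by
    intro b
    refine (ncard_canonicalSubset_le p k b).trans ?_
    have h1 := hsub l le_rfl hlr
    rw [add_mul, one_mul] at h1
    omega
  have hhull : ∀ b, l ≤ b → b < r → ∀ z ∈ canonicalSubset p k b,
      z ∈ convexHull ℝ (p '' Set.Icc i j) := fun b h1 h2 z hz =>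
    subset_convexHull ℝ _ (canonicalSubset_subset p (hsub b h1 h2).1 (hsub b h1 h2).2 hz)
  obtain ⟨hp3, hp4⟩ := h.ptr hlr
  refine Wp.weaken (T := 2 + ((240 * M + 540) + (2 + ((240 * M + 540) + 13)))) (by omega) ?_
  refine Wp.seq (R := fun s' => s'.nat 6 = addr k l ∧ (∀ r, r < 6 → s'.nat r = s.nat r) ∧
    s'.real = s.real) (Wp.instrs ⟨?_, fun r hr => ?_, ?_⟩) ?_
  · simp [applyAll, Instr.apply, hp3]
  · simp [applyAll, Instr.apply, hr.ne]
  · simp [applyAll, Instr.apply]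
  rintro s1 ⟨a1, a2, a3⟩
  have q1 : s1.pair 0 = q := by rw [← h.query]; simp [Regs.pair, a3]
  refine Wp.seq (wp_node mem s1 M (finite_canonicalSubset p k l) (hcard l)
    (h.tracks.congr (a2 5 (by omega)) fun r _ _ => by rw [a3])
    (by rw [a1]; exact (hrec k l (hnode l hlr)).hull)) ?_
  rw [q1]
  rintro s2 ⟨F₁, b1, b2, b3, b4, b5, b6⟩
  refine Wp.seq (R := fun s' => s'.nat 6 = addr k (r - 1) ∧ (∀ r, r < 6 → s'.nat r = s2.nat r) ∧
    s'.real = s2.real) (Wp.instrs ⟨?_, fun r hr => ?_, ?_⟩) ?_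
  · simp [applyAll, Instr.apply, b5, a2, hp4]
  · simp [applyAll, Instr.apply, hr.ne]
  · simp [applyAll, Instr.apply]
  rintro s3 ⟨c1, c2, c3⟩
  have q3 : s3.pair 0 = q := by
    rw [← q1]; simp [Regs.pair, c3, b6]
  refine Wp.seq (wp_node mem s3 M (finite_canonicalSubset p k (r - 1)) (hcard _)
    (b1.congr (c2 5 (by omega)) fun r _ _ => by rw [c3])
    (by rw [c1]; exact (hrec k (r - 1) (hnode _ (by omega))).hull)) ?_
  rw [q3]
  rintro s4 ⟨F₂, d1, d2, d3, d4, d5, d6⟩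
  have hn : ∀ r, r < 5 → s4.nat r = s.nat r := fun r hr => by
    rw [d5 r hr, c2 r (by omega), b5 r hr, a2 r (by omega)]
  have e1 : s4.nat 1 = l := by rw [hn 1 (by omega), h.left]
  have e2 : s4.nat 2 = r := by rw [hn 2 (by omega), h.right]
  have e3 : s4.nat 3 = addr k l := by rw [hn 3 (by omega), hp3]
  have e4 : s4.nat 4 = addr k (r - 1) := by rw [hn 4 (by omega), hp4]
  have hl2 : l * 2 ^ k ≤ (l + 1) / 2 * 2 ^ (k + 1) := by
    rw [pow_succ', ← mul_assoc]
    exact Nat.mul_le_mul_right _ (by omega)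
  have hl2' : (l + 1) / 2 * 2 ^ (k + 1) ≤ (l + 1) * 2 ^ k := by
    rw [pow_succ', ← mul_assoc]
    exact Nat.mul_le_mul_right _ (by omega)
  have hr2 : r / 2 * 2 ^ (k + 1) ≤ r * 2 ^ k := by
    rw [pow_succ', ← mul_assoc]
    exact Nat.mul_le_mul_right _ (by omega)
  have hr2' : (r - 1) * 2 ^ k ≤ r / 2 * 2 ^ (k + 1) := by
    rw [pow_succ', ← mul_assoc]
    exact Nat.mul_le_mul_right _ (by omega)
  have hr1 : (r - 1 + 1) * 2 ^ k = r * 2 ^ k := by rw [Nat.sub_add_cancel (by omega)]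
  refine Wp.instrs ⟨F₂, ?_, ?_, ?_, fun hlr' => ⟨?_, ?_⟩, h.le_left.trans hl2,
    hr2.trans h.right_le, ?_, ?_, ?_⟩
  · simp [applyAll, Instr.apply, e1]
  · simp [applyAll, Instr.apply, e2]
  · rw [← q3]
    simp [applyAll, Instr.apply, Regs.pair, d6]
  -- The new left block `⌈l / 2⌉` is the parent of `l + 1` for either parity, whereas the parent of
  -- an odd `l` sticks out to the left. On the other side the parent of `r - 2` is used. If blocks
  -- remain on the next level then `l + 2 ≤ r`, so these pointers are not null; otherwise the values
  -- loaded are never used.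
  · have n1 : mem.nat (addr k l + 4) = addr k (l + 1) := by
      rw [(hrec k l (hnode l hlr)).next, pointer, if_pos (hnode (l + 1) (by omega))]
    have n2 : mem.nat (addr k (l + 1)) = addr (k + 1) ((l + 1) / 2) := by
      rw [(hrec k (l + 1) (hnode (l + 1) (by omega))).parent, pointer, if_pos]
      exact isNode_of_mul_le (((Nat.mul_le_mul_right _ hlr').trans (hr2.trans h.right_le)).trans j.2)
    simp [applyAll, Instr.apply, e3, n1, n2]
  · have n1 : mem.nat (addr k (r - 1) + 3) = addr k (r - 2) := by
      rw [(hrec k (r - 1) (hnode _ (by omega))).prev, if_neg (by omega), pointer,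
        show r - 1 - 1 = r - 2 by omega, if_pos (hnode (r - 2) (by omega))]
    have n2 : mem.nat (addr k (r - 2)) = addr (k + 1) (r / 2 - 1) := by
      rw [(hrec k (r - 2) (hnode _ (by omega))).parent, pointer,
        show (r - 2) / 2 = r / 2 - 1 by omega, if_pos]
      refine isNode_of_mul_le (le_trans ?_ ((hr2.trans h.right_le).trans j.2))
      rw [Nat.sub_add_cancel (by omega)]
    simp [applyAll, Instr.apply, e4, n1, n2]
  · refine d1.congr ?_ fun r _ _ => ?_
    · simp [applyAll, Instr.apply]
    · simp [applyAll, Instr.apply]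
  · intro x hx
    rcases d3 x hx with hx | hx
    · rcases b3 x hx with hx | hx
      · exact h.mem_hull x hx
      · exact hhull l le_rfl hlr _ hx
    · exact hhull (r - 1) (by omega) (by omega) _ hx
  · by_cases h0 : 0 ∈ F₂
    · exact .inl h0
    right
    have hmono : ∀ {G : Set (ℝ × ℝ)}, G ⊆ F₂ → convexHull ℝ {x | Spans G x} ⊆
        convexHull ℝ {x | Spans F₂ x} := fun hG => convexHull_mono fun x hx => hx.mono hG
    have b4' := b4.resolve_left fun hc => h0 (d2 hc)
    have d4' := d4.resolve_left h0
    have h' := h.covered.resolve_left fun hc => h0 (d2 (b2 hc))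
    rintro t ht1 ht2 (ht | ht)
    · by_cases hc : (t : ℕ) < l * 2 ^ k
      · exact hmono (b2.trans d2) (h' t ht1 ht2 (.inl hc))
      · exact hmono d2 (b4' _ ⟨t, ⟨by omega, by omega⟩, rfl⟩)
    · by_cases hc : r * 2 ^ k ≤ t
      · exact hmono (b2.trans d2) (h' t ht1 ht2 (.inr hc))
      · exact d4' _ ⟨t, ⟨by omega, by omega⟩, rfl⟩

/-- The number `r - l` of remaining blocks at least halves on each level, so `M` rounds empty the
interval; then every point of the window is covered and `wp_answer` applies. -/
theorem wp_tangentQuery {n : ℕ} {mem : Memory} {p : Fin n → ℝ × ℝ} {A : ℕ}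
    (hmem : StoresDecomposition mem A p) {i j : Fin n} (hij : i ≤ j) (q : ℝ × ℝ) {M : ℕ}
    (hM : (j : ℕ) + 1 - i < 2 ^ M) :
    Wp mem tangentQuery (queryRegs A i j q) (M * (480 * M + 1101) + 38)
      (AnswersTangentQuery (convexHull ℝ (p '' Set.Icc i j)) q) := by
  obtain ⟨addr, hleaf, hrec⟩ := hmem
  have hij' : (i : ℕ) ≤ j := hij
  let I : ℕ → Regs → Prop := fun N s => ∃ F k l r, AtLevel p addr i j q F k l r s ∧ r - l < 2 ^ N
  refine Wp.weaken (T := 7 + ((M * ((480 * M + 1100) + 1) + 1) + 30))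
    (by rw [add_assoc (480 * M)]; omega) ?_
  refine Wp.seq (R := I M) (Wp.instrs ⟨∅, 0, i, j + 1, ⟨?_, ?_, ?_, fun _ => ⟨?_, ?_⟩, ?_, ?_, ?_, ?_,
    ?_⟩, hM⟩) fun s hs => ?_
  · simp [applyAll, Instr.apply, queryRegs]
  · simp [applyAll, Instr.apply, queryRegs]
  · simp [applyAll, Instr.apply, queryRegs, Regs.pair]
  · simp [applyAll, Instr.apply, queryRegs, hleaf]
  · simp [applyAll, Instr.apply, queryRegs, hleaf]
  · simp
  · simp
  · have hz : ∀ r, 2 ≤ r → (applyAll mem [.natAdd 20 0 1, .natLoad 3 20, .natAdd 20 0 2,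
        .natLoad 4 20, .natConst 20 1, .natAdd 2 2 20] (queryRegs A i j q)).pair r = 0 := by
      intro r hr
      simp [applyAll, Instr.apply, queryRegs, Regs.pair, show r ≠ 0 by omega, show r ≠ 1 by omega]
    refine ⟨?_, ?_, ?_⟩
    · simp [applyAll, Instr.apply, queryRegs]
    · rw [hz 2 (by omega), hz 4 (by omega)]
      exact .inl ⟨rfl, rfl, by simp⟩
    · rw [hz 6 (by omega), hz 8 (by omega)]
      exact .inl ⟨by simp, by simp, by simp⟩
  · simp
  · right
    rintro t h1 h2 (h | h)
    · have : (i : ℕ) ≤ t := h1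
      omega
    · have : (t : ℕ) ≤ j := h2
      omega
  refine Wp.seq (Wp.loop (I := I) (T := 480 * M + 1100) ?_ M s hs) ?_
  · rintro N s ⟨F, k, l, r, h, hN⟩ he
    simp only [Test.Holds, h.left, h.right] at he
    obtain ⟨N, rfl⟩ : ∃ N', N = N' + 1 := by
      refine ⟨N - 1, ?_⟩
      rcases N with _ | N
      · rw [pow_zero] at hN; omega
      · omega
    refine ⟨N, rfl, (wp_level hrec h he hM).mono le_rfl ?_⟩
    rintro s' ⟨F', h'⟩
    rw [pow_succ] at hN
    exact ⟨F', _, _, _, h', by omega⟩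
  · rintro s ⟨⟨_, F, k, l, r, h, -⟩, he⟩
    simp only [Test.Holds, h.left, h.right, not_lt] at he
    rw [← h.query]
    refine wp_answer mem s (convex_convexHull ℝ _) ?_ h.tracks ?_ ?_
    · exact ⟨p i, subset_convexHull ℝ _ ⟨i, ⟨le_rfl, hij⟩, rfl⟩⟩
    · rw [h.query]; exact h.mem_hull
    · rw [h.query]
      refine h.covered.imp_right fun hc z hz => ?_
      refine convexHull_min (s := p '' Set.Icc i j) ?_
        (convex_preimage_sub (convex_convexHull ℝ {x | Spans F x}) q) hz
      rintro _ ⟨t, ht, rfl⟩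
      refine hc t ht.1 ht.2 ?_
      -- From `r ≤ l` every time is before `l * 2 ^ k` or not before `r * 2 ^ k`.
      have := Nat.mul_le_mul_right (2 ^ k) he
      omega

end WindowHull

theorem mainTheorem6 :
    ∃ (query : WindowHull.Program) (C : ℕ),
      ∀ (n : ℕ) (p : Fin n → ℝ × ℝ) (mem : WindowHull.Memory) (A : ℕ),
        WindowHull.StoresDecomposition mem A p →
        ∀ (i j : Fin n), i ≤ j → ∀ (q : ℝ × ℝ) (w : ℕ), w = (j : ℕ) - (i : ℕ) + 1 →
          ∃ (t : ℕ) (s : WindowHull.Regs),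
            WindowHull.Exec mem query (WindowHull.queryRegs A i j q) t s ∧
            t ≤ C * (Nat.log 2 w + 1) ^ 2 ∧
            WindowHull.AnswersTangentQuery (convexHull ℝ (p '' Set.Icc i j)) q s := by
  -- With `M = Nat.log 2 w + 1 ≥ 1` the bound `480 M ^ 2 + 1101 M + 38` is at most `1619 M ^ 2`; the
  -- constant is rounded up.
  refine ⟨WindowHull.tangentQuery, 2000, fun n p mem A hmem i j hij q w hw => ?_⟩
  have hij' : (i : ℕ) ≤ j := hij
  have hM : (j : ℕ) + 1 - i < 2 ^ (Nat.log 2 w + 1) := by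
    rw [show (j : ℕ) + 1 - i = w by omega]
    exact Nat.lt_pow_succ_log_self (by omega) w
  obtain ⟨t, s, h1, h2, h3⟩ := WindowHull.wp_tangentQuery hmem hij q hM
  refine ⟨t, s, h1, h2.trans ?_, h3⟩
  generalize Nat.log 2 w = L
  nlinarith [Nat.zero_le L]
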